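/- Let $N\ge 1$, $R=\mathbb Z/N\mathbb Z$ and $\omega=\exp(2\pi i/N)$. Let $\mathcal A=\mathbb Q\langle x,y_a\mid a\in R\rangle$ be the non-commutative polynomial algebra, $\mathcal A^1=\mathbb Q+\sum_{a\in R}\mathcal A y_a$, $\mathcal A^0=\mathbb Q+\sum_{a\in R}x\mathcal A y_a+\sum_{a,b\in R,\,b\ne 0}y_b\mathcal A y_a$, and $z_{k,a}=x^{k-1}y_a$ for $k\ge 1$, $a\in R$. The words $z_{k_1,a_1}\cdots z_{k_n,a_n}$ ($n\ge 0$) form a basis of $\mathcal A^1$. Let * $\mathcal L_\ast:\mathcal A^0\to\mathbb C$ be the $\mathbb Q$-linear map with $\mathcal L_\ast(1)=1$ and $$\mathcal L_\ast(z_{k_1,a_1}\cdots z_{k_n,a_n})=L_\ast(k_1,\dots,k_n;a_1,\dots,a_n)=\sum_{m_1>\cdots>m_n>0}\frac{\omega^{a_1m_1+\cdots+a_nm_n}}{m_1^{k_1}\cdots m_n^{k_n}},$$ the sum being the limit for $M\to\infty$ of the partial sums over $M>m_1>\cdots>m_n>0$, which exists whenever $k_1\ge 2$ or $a_1\ne 0$;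 * $\mathcal I:\mathcal A^1\to\mathcal A^1$ be the invertible $\mathbb Q$-linear map with $\mathcal I(z_{k_1,a_1}z_{k_2,a_2}\cdots z_{k_n,a_n})=z_{k_1,a_1}z_{k_2,a_1+a_2}\cdots z_{k_n,a_1+\cdots+a_n}$; * $\ast$ be the $\mathbb Q$-bilinear product on $\mathcal A^1$ with $1\ast w=w\ast 1=w$ and $z_{k,a}w_1\ast z_{l,b}w_2=z_{k,a}(w_1\ast z_{l,b}w_2)+z_{l,b}(z_{k,a}w_1\ast w_2)+z_{k+l,a+b}(w_1\ast w_2)$ for words $w,w_1,w_2$ of $\mathcal A^1$; * ш be the shuffle product on $\mathcal A$, i.e. the $\mathbb Q$-bilinear product with $1$ ш $w=w$ ш $1=w$ and $uw_1$ ш $vw_2=u(w_1$ ш $vw_2)+v(uw_1$ ш $w_2)$ for letters $u,v$ and words $w,w_1,w_2$; it maps $\mathcal A^1\times\mathcal A^1$ to $\mathcal A^1$. Let $k,n$ be integers with $n\ge 2$ and $k\ge n+1$, and let $a,a_1,\dots,a_{n-1}\in R$. Put $d_1=a_1$ and $d_j=a_j-a_{j-1}$ for $2\le j\le n-1$. In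 all sums below the $k_j$ and $l$ are integers $\geq 1$. Then the sum $$\sum_{\substack{l+k_1+\cdots+k_{n-1}=k\\ k_1\ge 2}}\Bigl(\mathcal I^{-1}\bigl(z_{l,a}\text{ ш }z_{k_1,a_1}\cdots z_{k_{n-1},a_{n-1}}\bigr)-\mathcal I^{-1}(z_{l,a})\ast\mathcal I^{-1}\bigl(z_{k_1,a_1}\cdots z_{k_{n-1},a_{n-1}}\bigr)\Bigr)$$ is equal to $$\begin{aligned} &\sum_{\substack{k_1+\cdots+k_n=k\\ k_2\ge 2}}2^{k_1-1}\,z_{k_1,a}z_{k_2,a_1-a}z_{k_3,d_2}\cdots z_{k_n,d_{n-1}} +\sum_{\substack{k_1+\cdots+k_n=k\\ k_1\ge 2,\,k_2=1}}(2^{k_1-1}-1)\,z_{k_1,a}z_{k_2,a_1-a}z_{k_3,d_2}\cdots z_{k_n,d_{n-1}}\\ &+\sum_{i=2}^{n-1}\sum_{\substack{k_1+\cdots+k_n=k\\ k_1\ge 2}}\bigl(2^{k_1+\cdots+k_i-i}-2^{k_2+\cdots+k_i-(i-1)}\bigr)z_{k_1,d_1}\cdots z_{k_{i-1},d_{i-1}}\,z_{k_i,a-a_{i-1}}z_{k_{i+1},a_i-a}\,z_{k_{i+2},d_{i+1}}\cdots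 z_{k_n,d_{n-1}}\\ &+\sum_{\substack{k_1+\cdots+k_n=k\\ k_1\ge 2}}\bigl(2^{k_1+\cdots+k_{n-1}-(n-1)}-2^{k_2+\cdots+k_{n-1}-(n-2)}\bigr)z_{k_1,d_1}\cdots z_{k_{n-1},d_{n-1}}z_{k_n,a-a_{n-1}}\\ &-\sum_{\substack{k_1+\cdots+k_n=k\\ k_2\ge 2}}z_{k_1,a}z_{k_2,d_1}z_{k_3,d_2}\cdots z_{k_n,d_{n-1}} -\sum_{i=1}^{n-1}\sum_{\substack{k_1+\cdots+k_n=k\\ k_1\ge 2}}z_{k_1,d_1}\cdots z_{k_i,d_i}\,z_{k_{i+1},a}\,z_{k_{i+2},d_{i+1}}\cdots z_{k_n,d_{n-1}}\\ &-\sum_{\substack{k_1+\cdots+k_{n-1}=k\\ k_1\ge 2}}(k_1-2)\,z_{k_1,a+a_1}z_{k_2,d_2}\cdots z_{k_{n-1},d_{n-1}}\\ &-\sum_{i=2}^{n-1}\sum_{\substack{k_1+\cdots+k_{n-1}=k\\ k_1\ge 2}}(k_i-1)\,z_{k_1,d_1}\cdots z_{k_{i-1},d_{i-1}}\,z_{k_i,a+a_i-a_{i-1}}\,z_{k_{i+1},d_{i+1}}\cdots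 z_{k_{n-1},d_{n-1}}. \end{aligned}$$ Moreover, this combination of words belongs to $\mathcal A^0$ and to $\ker(\mathcal L_\ast)$. -/

import Mathlib

noncomputable section

namespace MultipleL

/-- The alphabet `{x, y_a | a ∈ ℤ/Nℤ}`. -/
inductive Letter (N : ℕ) : Type
  | x : Letter N
  | y : ZMod N → Letter N

/-- The non-commutative polynomial algebra `𝒜 = ℚ⟨x, y_a | a ∈ ℤ/Nℤ⟩`. -/
abbrev A (N : ℕ) : Type := FreeAlgebra ℚ (Letter N)

variable {N : ℕ}

/-- The generator `x` of `𝒜`. -/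
def X : A N := FreeAlgebra.ι ℚ Letter.x

/-- The generator `y_a` of `𝒜`. -/
def Y (a : ZMod N) : A N := FreeAlgebra.ι ℚ (Letter.y a)

/-- A word in the letters, as an element of `𝒜`. -/
def word (w : List (Letter N)) : A N := (w.map (FreeAlgebra.ι ℚ)).prod

/-- `z_{k,a} = x^{k-1} y_a` (used for `k ≥ 1` only). -/
def z (k : ℕ) (a : ZMod N) : A N := X ^ (k - 1) * Y a

variable (N) in
/-- `𝒜¹ = ℚ + ∑_a 𝒜 y_a`. -/
def A1 : Submodule ℚ (A N) :=
  Submodule.span ℚ ({1} ∪ {p | ∃ (u : A N) (a : ZMod N), p = u * Y a})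

variable (N) in
/-- `𝒜⁰ = ℚ + ∑_a x 𝒜 y_a + ∑_{a, b, b ≠ 0} y_b 𝒜 y_a`. -/
def A0 : Submodule ℚ (A N) :=
  Submodule.span ℚ ({1} ∪ {p | ∃ (u : A N) (a : ZMod N), p = X * u * Y a} ∪
    {p | ∃ (u : A N) (a b : ZMod N), b ≠ 0 ∧ p = Y b * u * Y a})

theorem A0_le_A1 : A0 N ≤ A1 N := by
  refine Submodule.span_le.2 ?_
  rintro p ((hp | ⟨u, a, rfl⟩) | ⟨u, a, b, -, rfl⟩)
  · exact Submodule.subset_span (Or.inl hp)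
  · exact Submodule.subset_span (Or.inr ⟨X * u, a, rfl⟩)
  · exact Submodule.subset_span (Or.inr ⟨Y b * u, a, rfl⟩)

/-- A list `[(k₁, a₁), …, (kₙ, aₙ)]`, standing for the word `z_{k₁,a₁} ⋯ z_{kₙ,aₙ}`. -/
abbrev ZWord (N : ℕ) : Type := List (ℕ+ × ZMod N)

/-- The element `z_{k₁,a₁} ⋯ z_{kₙ,aₙ}` of `𝒜`. -/
def ofZWord (w : ZWord N) : A N := (w.map fun p => z (p.1 : ℕ) p.2).prod

/-! ### The words `z_{k₁,a₁} ⋯ z_{kₙ,aₙ}` form a basis of `𝒜¹` -/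

/-- The letters of `z_{k₁,a₁} ⋯ z_{kₙ,aₙ}`. -/
def letters : ZWord N → List (Letter N)
  | [] => []
  | (k, a) :: w => List.replicate ((k : ℕ) - 1) Letter.x ++ Letter.y a :: letters w

theorem word_letters (w : ZWord N) : word (letters w) = ofZWord w := by
  induction w with
  | nil => rfl
  | cons p w ih =>
    obtain ⟨k, a⟩ := p
    have h : word (letters ((k, a) :: w)) = z (k : ℕ) a * word (letters w) := by
      simp [letters, word, z, X, Y, mul_assoc]
    rw [h, ih]
    simp [ofZWord]

theorem replicate_x_append_inj {m m' : ℕ} {a a' : ZMod N} {u u' : List (Letter N)}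
    (h : List.replicate m Letter.x ++ Letter.y a :: u =
      List.replicate m' Letter.x ++ Letter.y a' :: u') : m = m' ∧ a = a' ∧ u = u' := by
  induction m generalizing m' with
  | zero =>
    cases m' with
    | zero => simpa using h
    | succ m' => simp [List.replicate_succ] at h
  | succ m ih =>
    cases m' with
    | zero => simp [List.replicate_succ] at h
    | succ m' =>
      simp only [List.replicate_succ, List.cons_append, List.cons.injEq, true_and] at h
      obtain ⟨h1, h2⟩ := ih h
      exact ⟨by rw [h1], h2⟩

theorem letters_injective : Function.Injective (letters (N := N)) := by
  intro w
  induction w with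
  | nil =>
    rintro (_ | ⟨⟨k, a⟩, w'⟩) h
    · rfl
    · simp [letters] at h
  | cons p w ih =>
    obtain ⟨k, a⟩ := p
    rintro (_ | ⟨⟨k', a'⟩, w'⟩) h
    · simp [letters] at h
    · obtain ⟨h1, h2, h3⟩ := replicate_x_append_inj h
      have hk : k = k' := by
        have := k.pos
        have := k'.pos
        exact PNat.eq (by omega)
      rw [hk, h2, ih h3]

theorem exists_letters (u : List (Letter N)) (a : ZMod N) :
    ∃ w : ZWord N, w ≠ [] ∧ letters w = u ++ [Letter.y a] := by
  induction u with
  | nil => exact ⟨[(1, a)], by simp, by simp [letters]⟩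
  | cons c u ih =>
    obtain ⟨w, hw, h⟩ := ih
    cases c with
    | y b => exact ⟨(1, b) :: w, by simp, by simp [letters, h]⟩
    | x =>
      match w, hw with
      | (k, b) :: w, _ =>
        refine ⟨(k + 1, b) :: w, by simp, ?_⟩
        have hk : ((k + 1 : ℕ+) : ℕ) - 1 = ((k : ℕ) - 1) + 1 := by
          have := k.pos
          simp
          omega
        rw [List.cons_append, ← h]
        simp only [letters, hk, List.replicate_succ, List.cons_append]

theorem basisFreeMonoid_eq_word (w : List (Letter N)) :
    FreeAlgebra.basisFreeMonoid ℚ (Letter N) (FreeMonoid.ofList w) = word w := by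
  simp [FreeAlgebra.basisFreeMonoid, word, FreeAlgebra.equivMonoidAlgebraFreeMonoid,
    MonoidAlgebra.lift_apply, FreeMonoid.lift_apply]

theorem word_mem_span (p : A N) : p ∈ Submodule.span ℚ (Set.range (word (N := N))) := by
  have h := (FreeAlgebra.basisFreeMonoid ℚ (Letter N)).mem_span p
  refine Submodule.span_mono ?_ h
  rintro _ ⟨w, rfl⟩
  exact ⟨FreeMonoid.toList w, (basisFreeMonoid_eq_word _).symm⟩

theorem linearIndependent_ofZWord : LinearIndependent ℚ (ofZWord (N := N)) := by
  have h := (FreeAlgebra.basisFreeMonoid ℚ (Letter N)).linearIndependent.comp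
    (fun w : ZWord N => FreeMonoid.ofList (letters w))
    (fun _ _ h => letters_injective (FreeMonoid.ofList.injective h))
  have e : (FreeAlgebra.basisFreeMonoid ℚ (Letter N)) ∘
      (fun w : ZWord N => FreeMonoid.ofList (letters w)) = ofZWord := by
    funext w
    simp only [Function.comp_apply]
    rw [basisFreeMonoid_eq_word, word_letters]
  rwa [e] at h

theorem span_ofZWord : Submodule.span ℚ (Set.range (ofZWord (N := N))) = A1 N := by
  apply le_antisymm
  · refine Submodule.span_le.2 ?_
    rintro _ ⟨w, rfl⟩
    rcases List.eq_nil_or_concat w with rfl | ⟨v, p, rfl⟩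
    · exact Submodule.subset_span (Or.inl rfl)
    · refine Submodule.subset_span (Or.inr ⟨ofZWord v * X ^ ((p.1 : ℕ) - 1), p.2, ?_⟩)
      simp [ofZWord, z, mul_assoc]
  · refine Submodule.span_le.2 ?_
    rintro p (hp | ⟨u, a, rfl⟩)
    · exact Submodule.subset_span ⟨[], hp.symm⟩
    · have hu := word_mem_span u
      induction hu using Submodule.span_induction with
      | mem q hq =>
        obtain ⟨v, rfl⟩ := hq
        obtain ⟨w, -, hw⟩ := exists_letters v a
        refine Submodule.subset_span ⟨w, ?_⟩
        rw [← word_letters, hw]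
        simp [word, Y]
      | zero => simp
      | add p q _ _ hp hq =>
        rw [add_mul]
        exact add_mem hp hq
      | smul c p _ hp =>
        rw [smul_mul_assoc]
        exact Submodule.smul_mem _ c hp

/-- The basis of `𝒜¹` consisting of the words `z_{k₁,a₁} ⋯ z_{kₙ,aₙ}`, `n ≥ 0`. -/
def zBasis : Module.Basis (ZWord N) ℚ (A1 N) :=
  (Module.Basis.span linearIndependent_ofZWord).map
    (LinearEquiv.ofEq _ _ span_ofZWord)

theorem coe_zBasis (w : ZWord N) : (zBasis w : A N) = ofZWord w := by
  simp [zBasis, Module.Basis.span_apply]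

/-! ### The map `ℐ` -/

/-- `[(k₁, a₁), (k₂, a₂), …] ↦ [(k₁, s + a₁), (k₂, s + a₁ + a₂), …]`. -/
def partialSums : ZMod N → ZWord N → ZWord N
  | _, [] => []
  | s, (k, a) :: w => (k, s + a) :: partialSums (s + a) w

/-- `[(k₁, a₁), (k₂, a₂), …] ↦ [(k₁, a₁ - s), (k₂, a₂ - a₁), …]`. -/
def differences : ZMod N → ZWord N → ZWord N
  | _, [] => []
  | s, (k, a) :: w => (k, a - s) :: differences a w

theorem differences_partialSums (s : ZMod N) (w : ZWord N) :
    differences s (partialSums s w) = w := by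
  induction w generalizing s with
  | nil => rfl
  | cons p w ih => simp [partialSums, differences, ih]

theorem partialSums_differences (s : ZMod N) (w : ZWord N) :
    partialSums s (differences s w) = w := by
  induction w generalizing s with
  | nil => rfl
  | cons p w ih => simp [partialSums, differences, ih]

/-- The bijection of words underlying `ℐ`. -/
def partialSumsEquiv : ZWord N ≃ ZWord N where
  toFun := partialSums 0
  invFun := differences 0
  left_inv := differences_partialSums 0
  right_inv := partialSums_differences 0

/-- The invertible `ℚ`-linear map `ℐ : 𝒜¹ → 𝒜¹`,
`z_{k₁,a₁} z_{k₂,a₂} ⋯ z_{kₙ,aₙ} ↦ z_{k₁,a₁} z_{k₂,a₁+a₂} ⋯ z_{kₙ,a₁+⋯+aₙ}`.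
Its inverse `ℐ⁻¹` is `calI.symm`. -/
def calI : A1 N ≃ₗ[ℚ] A1 N := zBasis.equiv zBasis partialSumsEquiv

/-! ### The harmonic shuffle product on `𝒜¹` -/

/-- Left multiplication by `z_{k,a}` on `𝒜¹`. -/
def consZ (k : ℕ+) (a : ZMod N) : A1 N →ₗ[ℚ] A1 N :=
  zBasis.constr ℚ fun w => zBasis ((k, a) :: w)

theorem coe_consZ (k : ℕ+) (a : ZMod N) (p : A1 N) :
    (consZ k a p : A N) = z (k : ℕ) a * (p : A N) := by
  have h : (A1 N).subtype ∘ₗ consZ k a =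
      LinearMap.mulLeft ℚ (z (k : ℕ) a) ∘ₗ (A1 N).subtype := by
    refine zBasis.ext fun w => ?_
    simp [consZ, coe_zBasis, ofZWord]
  exact LinearMap.congr_fun h p

/-- The harmonic shuffle product of two words in the `z_{k,a}`. -/
def harmonicWord : ZWord N → ZWord N → A1 N
  | [], w => zBasis w
  | p :: v, [] => zBasis (p :: v)
  | (k, a) :: v, (l, b) :: w =>
      consZ k a (harmonicWord v ((l, b) :: w)) + consZ l b (harmonicWord ((k, a) :: v) w) +
        consZ (k + l) (a + b) (harmonicWord v w)
termination_by v w => v.length + w.length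

/-- The harmonic shuffle product `∗` on `𝒜¹`. -/
def harmonicProd : A1 N →ₗ[ℚ] A1 N →ₗ[ℚ] A1 N :=
  zBasis.constr ℚ fun v => zBasis.constr ℚ fun w => harmonicWord v w

/-! ### The shuffle product -/

/-- The shuffle product of two words. -/
def shuffleWord : List (Letter N) → List (Letter N) → A N
  | [], w => word w
  | c :: v, [] => word (c :: v)
  | c :: v, d :: w =>
      FreeAlgebra.ι ℚ c * shuffleWord v (d :: w) + FreeAlgebra.ι ℚ d * shuffleWord (c :: v) w
termination_by v w => v.length + w.length

/-- The shuffle product on `𝒜`. -/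
def shuffle : A N →ₗ[ℚ] A N →ₗ[ℚ] A N :=
  (FreeAlgebra.basisFreeMonoid ℚ (Letter N)).constr ℚ fun v =>
    (FreeAlgebra.basisFreeMonoid ℚ (Letter N)).constr ℚ fun w =>
      shuffleWord (FreeMonoid.toList v) (FreeMonoid.toList w)

theorem shuffle_word (v w : List (Letter N)) :
    shuffle (word v) (word w) = shuffleWord v w := by
  rw [← basisFreeMonoid_eq_word v, ← basisFreeMonoid_eq_word w]
  simp [shuffle, Module.Basis.constr_basis]

/-- The words that are empty or end in some `y_a`. -/
def GoodEnd (w : List (Letter N)) : Prop := w = [] ∨ ∃ u a, w = u ++ [Letter.y a]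

theorem GoodEnd.tail {c : Letter N} {w : List (Letter N)} (h : GoodEnd (c :: w)) :
    GoodEnd w := by
  rcases h with h | ⟨u, a, h⟩
  · simp at h
  · cases u with
    | nil =>
      simp at h
      exact Or.inl h.2
    | cons d u =>
      simp at h
      exact Or.inr ⟨u, a, h.2⟩

theorem goodEnd_letters (w : ZWord N) : GoodEnd (letters w) := by
  induction w with
  | nil => exact Or.inl rfl
  | cons p w ih =>
    obtain ⟨k, a⟩ := p
    rcases ih with h | ⟨u, b, h⟩
    · exact Or.inr ⟨List.replicate ((k : ℕ) - 1) Letter.x, a, by simp [letters, h]⟩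
    · exact Or.inr ⟨List.replicate ((k : ℕ) - 1) Letter.x ++ Letter.y a :: u, b,
        by simp [letters, h]⟩

variable (N) in
/-- `∑_a 𝒜 y_a`. -/
def A1pos : Submodule ℚ (A N) := Submodule.span ℚ {p | ∃ (u : A N) (a : ZMod N), p = u * Y a}

theorem mul_mem_A1pos (q : A N) {p : A N} (hp : p ∈ A1pos N) : q * p ∈ A1pos N := by
  induction hp using Submodule.span_induction with
  | mem p hp =>
    obtain ⟨u, a, rfl⟩ := hp
    exact Submodule.subset_span ⟨q * u, a, by rw [mul_assoc]⟩
  | zero => simp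
  | add p p' _ _ hp hp' =>
    rw [mul_add]
    exact add_mem hp hp'
  | smul c p _ hp =>
    rw [mul_smul_comm]
    exact Submodule.smul_mem _ c hp

theorem word_mem_A1pos {w : List (Letter N)} (hw : GoodEnd w) (hne : w ≠ []) :
    word w ∈ A1pos N := by
  rcases hw with h | ⟨u, a, rfl⟩
  · exact absurd h hne
  · exact Submodule.subset_span ⟨word u, a, by simp [word, Y]⟩

theorem shuffleWord_mem_A1pos (v w : List (Letter N)) (hv : GoodEnd v) (hw : GoodEnd w)
    (hne : v ≠ [] ∨ w ≠ []) : shuffleWord v w ∈ A1pos N := by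
  induction v, w using shuffleWord.induct with
  | case1 w =>
    rw [shuffleWord]
    exact word_mem_A1pos hw (by simpa using hne)
  | case2 c v =>
    rw [shuffleWord]
    exact word_mem_A1pos hv (by simp)
  | case3 c v d w ih1 ih2 =>
    rw [shuffleWord]
    exact add_mem (mul_mem_A1pos _ (ih1 hv.tail hw (by simp)))
      (mul_mem_A1pos _ (ih2 hv hw.tail (by simp)))

theorem shuffle_mem_A1 {p q : A N} (hp : p ∈ A1 N) (hq : q ∈ A1 N) : shuffle p q ∈ A1 N := by
  rw [← span_ofZWord] at hp hq
  have hle : A1pos N ≤ A1 N := Submodule.span_mono Set.subset_union_right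
  induction hp using Submodule.span_induction with
  | mem p hp =>
    obtain ⟨v, rfl⟩ := hp
    induction hq using Submodule.span_induction with
    | mem q hq =>
      obtain ⟨w, rfl⟩ := hq
      rw [← word_letters, ← word_letters, shuffle_word]
      by_cases h : letters v ≠ [] ∨ letters w ≠ []
      · exact hle (shuffleWord_mem_A1pos _ _ (goodEnd_letters v) (goodEnd_letters w) h)
      · push Not at h
        rw [h.1, h.2, shuffleWord]
        exact Submodule.subset_span (Or.inl rfl)
    | zero => simp
    | add q q' _ _ hq hq' =>
      rw [map_add]
      exact add_mem hq hq'
    | smul c q _ hq =>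
      rw [map_smul]
      exact Submodule.smul_mem _ c hq
  | zero => simp
  | add p p' _ _ hp hp' =>
    rw [map_add, LinearMap.add_apply]
    exact add_mem hp hp'
  | smul c p _ hp =>
    rw [map_smul, LinearMap.smul_apply]
    exact Submodule.smul_mem _ c hp

/-- The shuffle product restricted to `𝒜¹`. -/
def shuffleA1 (p q : A1 N) : A1 N :=
  ⟨shuffle (p : A N) (q : A N), shuffle_mem_A1 p.2 q.2⟩

/-! ### Multiple `L`-values -/

variable (N) in
/-- `ω = exp(2πi/N)`. -/
def omega : ℂ := Complex.exp (2 * Real.pi * Complex.I / N)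

/-- The truncated series
`∑_{M > m₁ > ⋯ > mₙ > 0} ω^{a₁ m₁ + ⋯ + aₙ mₙ} / (m₁^{k₁} ⋯ mₙ^{kₙ})`, as a nested sum. -/
def LStarTrunc : ZWord N → ℕ → ℂ
  | [], _ => 1
  | (k, a) :: w, M =>
      ∑ m ∈ Finset.Ico 1 M, omega N ^ (a.val * m) / (m : ℂ) ^ (k : ℕ) * LStarTrunc w m

/-- The multiple `L`-value `L_∗(k₁, …, kₙ; a₁, …, aₙ)`: the sum of the (possibly only
conditionally convergent) series, that is, the limit of its truncations. The limit exists
if `k₁ ≥ 2` or `a₁ ≠ 0`. -/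
def LStarValue (w : ZWord N) : ℂ := Filter.limUnder Filter.atTop (LStarTrunc w)

/-- The evaluation map `ℒ_∗ : 𝒜⁰ → ℂ`, `z_{k₁,a₁} ⋯ z_{kₙ,aₙ} ↦ L_∗(k₁, …, kₙ; a₁, …, aₙ)`. -/
def LStar : A0 N →ₗ[ℚ] ℂ := zBasis.constr ℚ LStarValue ∘ₗ Submodule.inclusion A0_le_A1

/-! ### The words and index sets of the weighted sum formula

Indices are the usual ones: a family `k₁, …, kₙ` is a function `κ : ℕ → ℕ` that vanishes
outside of `{1, …, n}`, and for labels `c₁, c₂, …` only the values that occur matter. -/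

/-- The families `(κ_j)_{j ∈ s}` of positive integers with sum `k`. -/
def comps (s : Finset ℕ) (k : ℕ) : Finset (ℕ → ℕ) :=
  {κ ∈ s.piAntidiag k | ∀ j ∈ s, 1 ≤ κ j}

/-- The element `z_{κ₁,c₁} z_{κ₂,c₂} ⋯ z_{κₙ,cₙ}` of `𝒜`. -/
def zProd (n : ℕ) (κ : ℕ → ℕ) (c : ℕ → ZMod N) : A N :=
  ((List.range n).map fun j => z (κ (j + 1)) (c (j + 1))).prod

theorem zProd_mem_A1 (n : ℕ) (κ : ℕ → ℕ) (c : ℕ → ZMod N) : zProd n κ c ∈ A1 N := by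
  cases n with
  | zero => exact Submodule.subset_span (Or.inl (by simp [zProd]))
  | succ n =>
    refine Submodule.subset_span (Or.inr ⟨zProd n κ c * X ^ (κ (n + 1) - 1), c (n + 1), ?_⟩)
    simp [zProd, List.range_succ, z, mul_assoc]

/-- `z_{κ₁,c₁} z_{κ₂,c₂} ⋯ z_{κₙ,cₙ}` as an element of `𝒜¹`. -/
def zProd1 (n : ℕ) (κ : ℕ → ℕ) (c : ℕ → ZMod N) : A1 N := ⟨zProd n κ c, zProd_mem_A1 n κ c⟩

/-- `z_{l,a}` as an element of `𝒜¹`. -/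
def z1 (l : ℕ) (a : ZMod N) : A1 N :=
  ⟨z l a, Submodule.subset_span (Or.inr ⟨X ^ (l - 1), a, rfl⟩)⟩

/-- The labels `a₁, a₂ - a₁, a₃ - a₂, …`. -/
def diffLabel (α : ℕ → ZMod N) (j : ℕ) : ZMod N :=
  if j = 1 then α 1 else α j - α (j - 1)

/-- The labels `a, a₁ - a, a₂ - a₁, a₃ - a₂, …`. -/
def frontDiffLabel (a : ZMod N) (α : ℕ → ZMod N) (j : ℕ) : ZMod N :=
  if j = 1 then a else if j = 2 then α 1 - a else diffLabel α (j - 1)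

/-- The labels `a₁, a₂ - a₁, …, a_{i-1} - a_{i-2}, a - a_{i-1}, a_i - a, a_{i+1} - a_i, …`,
for `i ≥ 2`. -/
def midDiffLabel (a : ZMod N) (α : ℕ → ZMod N) (i j : ℕ) : ZMod N :=
  if j < i then diffLabel α j
  else if j = i then a - α (i - 1)
  else if j = i + 1 then α i - a
  else diffLabel α (j - 1)

/-- The labels `a₁, a₂ - a₁, …, a_{n-1} - a_{n-2}, a - a_{n-1}`. -/
def backDiffLabel (a : ZMod N) (α : ℕ → ZMod N) (n j : ℕ) : ZMod N :=
  if j < n then diffLabel α j else a - α (n - 1)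

/-- The labels `a₁, a₂ - a₁, …, a_i - a_{i-1}, a, a_{i+1} - a_i, …`; for `i = 0` these are
`a, a₁, a₂ - a₁, …`. -/
def insertLabel (a : ZMod N) (α : ℕ → ZMod N) (i j : ℕ) : ZMod N :=
  if j ≤ i then diffLabel α j else if j = i + 1 then a else diffLabel α (j - 1)

/-- The labels `a₁, …, a_{i-1} - a_{i-2}, a + a_i - a_{i-1}, a_{i+1} - a_i, …`; for `i = 1`
these are `a + a₁, a₂ - a₁, …`. -/
def addLabel (a : ZMod N) (α : ℕ → ZMod N) (i j : ℕ) : ZMod N :=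
  if j = i then a + diffLabel α i else diffLabel α j

/-- The explicit combination of words in the weighted sum formula of weight `k` and depth `n`,
for `a` and `a₁ = α 1, …, a_{n-1} = α (n - 1)`. -/
def weightedSum (n k : ℕ) (a : ZMod N) (α : ℕ → ZMod N) : A N :=
  (∑ κ ∈ comps (Finset.Icc 1 n) k with 2 ≤ κ 2,
      (2 : ℚ) ^ (κ 1 - 1) • zProd n κ (frontDiffLabel a α))
  + (∑ κ ∈ comps (Finset.Icc 1 n) k with 2 ≤ κ 1 ∧ κ 2 = 1,
      ((2 : ℚ) ^ (κ 1 - 1) - 1) • zProd n κ (frontDiffLabel a α))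
  + (∑ i ∈ Finset.Icc 2 (n - 1), ∑ κ ∈ comps (Finset.Icc 1 n) k with 2 ≤ κ 1,
      ((2 : ℚ) ^ ((∑ j ∈ Finset.Icc 1 i, κ j) - i) -
        (2 : ℚ) ^ ((∑ j ∈ Finset.Icc 2 i, κ j) - (i - 1))) • zProd n κ (midDiffLabel a α i))
  + (∑ κ ∈ comps (Finset.Icc 1 n) k with 2 ≤ κ 1,
      ((2 : ℚ) ^ ((∑ j ∈ Finset.Icc 1 (n - 1), κ j) - (n - 1)) -
        (2 : ℚ) ^ ((∑ j ∈ Finset.Icc 2 (n - 1), κ j) - (n - 2))) •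
          zProd n κ (backDiffLabel a α n))
  - (∑ κ ∈ comps (Finset.Icc 1 n) k with 2 ≤ κ 2, zProd n κ (insertLabel a α 0))
  - (∑ i ∈ Finset.Icc 1 (n - 1), ∑ κ ∈ comps (Finset.Icc 1 n) k with 2 ≤ κ 1,
      zProd n κ (insertLabel a α i))
  - (∑ κ ∈ comps (Finset.Icc 1 (n - 1)) k with 2 ≤ κ 1,
      ((κ 1 : ℚ) - 2) • zProd (n - 1) κ (addLabel a α 1))
  - (∑ i ∈ Finset.Icc 2 (n - 1), ∑ κ ∈ comps (Finset.Icc 1 (n - 1)) k with 2 ≤ κ 1,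
      ((κ i : ℚ) - 1) • zProd (n - 1) κ (addLabel a α i))

end MultipleL

end

open MultipleL

/-!
Give `z_{k,b}` the weight `r ^ (k - 1) t ^ k` and sum over `k`. The letter recursion of `ш` turns
into a fixed point equation for these geometric series, whose solution shows that `ш` adds ratios:
`Z_r(a) ш Z_s(b) V = Z_{r+s}(a) Z_s(b) V + Z_{r+s}(b) (Z_r(a) ш V)`. Taking all ratios equal to `1`
produces the powers of `2`, and the condition `k₁ ≥ 2` is the difference of the ratios `1` and `0`
in the first factor. The harmonic product only contributes `Z_1(a) Z_1(b)` with coefficients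
`k - 1`, so the double shuffle combination is a coefficient of an explicit series.

For the kernel, truncating the sums at `m < M` makes `ℒ_∗` multiplicative for `∗`, while the
truncation of `ℐ⁻¹(w)` is the partial sum of the coefficients of the multiple polylogarithm of `w`.
Polylogarithms are iterated integrals, hence multiplicative for `ш`. The truncated double shuffle
combination is therefore the difference between the partial sums of a Cauchy product and the product
of the partial sums; it tends to `0`, since the coefficients of one factor are `O(1/m)` and those of
the other, as `k₁ ≥ 2`, are `O((log m)^d / m²)`.
-/

noncomputable section

namespace MultipleL

open Filter Topology
open Finset.HasAntidiagonal (antidiagonal)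
open PowerSeries (coeff C mk)
open ZMod (stdAddChar)

variable {N : ℕ}

/-! ### Generating series of words -/

/-- The generating series `∑_k g_k z_{k,b} t^k` with the coefficients of `g` as weights. -/
def zSeries (b : ZMod N) : PowerSeries ℚ →ₗ[ℚ] PowerSeries (A N) where
  toFun g := mk fun k => coeff k g • z k b
  map_add' f g := by ext k; simp [add_smul]
  map_smul' r g := by ext k; simp [mul_smul]

theorem coeff_zSeries (b : ZMod N) (g : PowerSeries ℚ) (k : ℕ) :
    coeff k (zSeries b g) = coeff k g • z k b := by
  simp [zSeries]

/-- The product of the series `∑_k (w_j)_k z_{k,c_j} t^k` for `j = 1, …, n`. -/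
def zSeriesProd (n : ℕ) (w : ℕ → PowerSeries ℚ) (c : ℕ → ZMod N) : PowerSeries (A N) :=
  ((List.range n).map fun j => zSeries (c (j + 1)) (w (j + 1))).prod

/-- The weights `r ^ (k - 1)` for `k ≥ 1`, as the power series `t / (1 - r t)`. For `r = 0` this
selects `k = 1`, so that `geomSeries 1 - geomSeries 0` selects `k ≥ 2`. -/
def geomSeries (r : ℚ) : PowerSeries ℚ := PowerSeries.X * mk fun k => r ^ k

theorem coeff_zero_geomSeries (r : ℚ) : coeff 0 (geomSeries r) = 0 := by
  simp [geomSeries]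

theorem coeff_geomSeries (r : ℚ) {k : ℕ} (hk : 1 ≤ k) : coeff k (geomSeries r) = r ^ (k - 1) := by
  obtain ⟨k, rfl⟩ := Nat.exists_eq_add_of_le' hk
  simp [geomSeries, PowerSeries.coeff_succ_X_mul]

theorem zSeriesProd_zero (w : ℕ → PowerSeries ℚ) (c : ℕ → ZMod N) : zSeriesProd 0 w c = 1 := by
  simp [zSeriesProd]

theorem zSeriesProd_succ (n : ℕ) (w : ℕ → PowerSeries ℚ) (c : ℕ → ZMod N) :
    zSeriesProd (n + 1) w c =
      zSeries (c 1) (w 1) * zSeriesProd n (fun j => w (j + 1)) (fun j => c (j + 1)) := by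
  simp [zSeriesProd, List.range_succ_eq_map, List.map_map, Function.comp_def]

theorem zSeriesProd_congr {n : ℕ} {w w' : ℕ → PowerSeries ℚ} {c c' : ℕ → ZMod N}
    (hw : ∀ j, 1 ≤ j → j ≤ n → w j = w' j) (hc : ∀ j, 1 ≤ j → j ≤ n → c j = c' j) :
    zSeriesProd n w c = zSeriesProd n w' c' := by
  unfold zSeriesProd
  congr 1
  refine List.map_congr_left fun j hj => ?_
  rw [List.mem_range] at hj
  rw [hw _ (by omega) (by omega), hc _ (by omega) (by omega)]

theorem zSeriesProd_succ_update_one (n : ℕ) (w : ℕ → PowerSeries ℚ) (g : PowerSeries ℚ)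
    (c : ℕ → ZMod N) :
    zSeriesProd (n + 1) (Function.update w 1 g) c =
      zSeries (c 1) g * zSeriesProd n (fun j => w (j + 1)) (fun j => c (j + 1)) := by
  rw [zSeriesProd_succ, Function.update_self]
  rfl

theorem zSeriesProd_succ_update_one_sub (n : ℕ) (w : ℕ → PowerSeries ℚ) (f g : PowerSeries ℚ)
    (c : ℕ → ZMod N) :
    zSeriesProd (n + 1) (Function.update w 1 (f - g)) c =
      zSeriesProd (n + 1) (Function.update w 1 f) c -
        zSeriesProd (n + 1) (Function.update w 1 g) c := by
  simp only [zSeriesProd_succ_update_one, map_sub, sub_mul]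

theorem zProd_succ (n : ℕ) (κ : ℕ → ℕ) (c : ℕ → ZMod N) :
    zProd (n + 1) κ c =
      z (κ 1) (c 1) * zProd n (fun j => κ (j + 1)) (fun j => c (j + 1)) := by
  simp [zProd, List.range_succ_eq_map, List.map_map, Function.comp_def]

theorem zProd_congr {n : ℕ} {κ κ' : ℕ → ℕ} {c c' : ℕ → ZMod N}
    (hκ : ∀ j, 1 ≤ j → j ≤ n → κ j = κ' j) (hc : ∀ j, 1 ≤ j → j ≤ n → c j = c' j) :
    zProd n κ c = zProd n κ' c' := by
  unfold zProd
  congr 1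
  refine List.map_congr_left fun j hj => ?_
  rw [List.mem_range] at hj
  rw [hκ _ (by omega) (by omega), hc _ (by omega) (by omega)]

theorem sum_piAntidiag_cons {ι M : Type*} [DecidableEq ι] [AddCommMonoid M] {s : Finset ι} {i : ι}
    (hi : i ∉ s) (k : ℕ) (f : (ι → ℕ) → M) :
    ∑ κ ∈ (Finset.cons i s hi).piAntidiag k, f κ =
      ∑ p ∈ antidiagonal k, ∑ κ ∈ s.piAntidiag p.2, f (Function.update κ i p.1) := by
  rw [Finset.piAntidiag_cons hi, Finset.sum_disjiUnion]
  refine Finset.sum_congr rfl fun p _ => ?_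
  rw [Finset.sum_map]
  refine Finset.sum_congr rfl fun κ hκ => congrArg f ?_
  have h0 : κ i = 0 := by_contra fun h => hi ((Finset.mem_piAntidiag.1 hκ).2 i h)
  funext j
  rcases eq_or_ne j i with rfl | hj
  · simp [h0]
  · simp [hj]

theorem sum_piAntidiag_cons_prod_smul {ι R M : Type*} [DecidableEq ι] [CommSemiring R]
    [AddCommMonoid M] [Module R M] {s : Finset ι} {i : ι} (hi : i ∉ s) (k : ℕ)
    (w : ι → PowerSeries R) (F : (ι → ℕ) → M) :
    ∑ κ ∈ (Finset.cons i s hi).piAntidiag k,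
        (∏ j ∈ Finset.cons i s hi, coeff (κ j) (w j)) • F κ =
      ∑ p ∈ antidiagonal k, coeff p.1 (w i) • ∑ κ ∈ s.piAntidiag p.2,
        (∏ j ∈ s, coeff (κ j) (w j)) • F (Function.update κ i p.1) := by
  rw [sum_piAntidiag_cons]
  refine Finset.sum_congr rfl fun p _ => ?_
  rw [Finset.smul_sum]
  refine Finset.sum_congr rfl fun κ _ => ?_
  have hs : ∏ j ∈ s, coeff (Function.update κ i p.1 j) (w j) = ∏ j ∈ s, coeff (κ j) (w j) :=
    Finset.prod_congr rfl fun j hj => by rw [Function.update_of_ne (ne_of_mem_of_not_mem hj hi)]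
  rw [Finset.prod_cons, Function.update_self, hs, mul_smul]

theorem zProd_succ_last_update (n : ℕ) (κ : ℕ → ℕ) (k : ℕ) (c : ℕ → ZMod N) :
    zProd (n + 1) (Function.update κ (n + 1) k) c = zProd n κ c * z k (c (n + 1)) := by
  have h : zProd n (Function.update κ (n + 1) k) c = zProd n κ c :=
    zProd_congr (fun j _ hj => Function.update_of_ne (by omega) _ _) fun _ _ _ => rfl
  rw [← h]
  simp [zProd, List.range_succ]

theorem Icc_one_succ_eq_cons (n : ℕ) :
    Finset.Icc 1 (n + 1) = Finset.cons (n + 1) (Finset.Icc 1 n) (by simp) := by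
  ext j
  simp only [Finset.mem_Icc, Finset.mem_cons]
  omega

theorem coeff_zSeriesProd (n k : ℕ) (w : ℕ → PowerSeries ℚ) (c : ℕ → ZMod N) :
    coeff k (zSeriesProd n w c) =
      ∑ κ ∈ (Finset.Icc 1 n).piAntidiag k,
        (∏ j ∈ Finset.Icc 1 n, coeff (κ j) (w j)) • zProd n κ c := by
  induction n generalizing k with
  | zero =>
    rw [zSeriesProd_zero, PowerSeries.coeff_one, Finset.Icc_eq_empty (by simp),
      Finset.piAntidiag_empty]
    split_ifs <;> simp [zProd]
  | succ n ih =>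
    have hs : zSeriesProd (n + 1) w c = zSeriesProd n w c * zSeries (c (n + 1)) (w (n + 1)) := by
      simp [zSeriesProd, List.range_succ]
    rw [hs, PowerSeries.coeff_mul, Icc_one_succ_eq_cons, sum_piAntidiag_cons_prod_smul,
      ← Finset.Nat.sum_antidiagonal_swap]
    refine Finset.sum_congr rfl fun p _ => ?_
    simp only [zProd_succ_last_update, Prod.fst_swap, Prod.snd_swap, coeff_zSeries, ih,
      mul_smul_comm, Finset.sum_mul, smul_mul_assoc]

theorem coeff_zSeriesProd_mem_A1 (n k : ℕ) (w : ℕ → PowerSeries ℚ) (c : ℕ → ZMod N) :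
    coeff k (zSeriesProd n w c) ∈ A1 N := by
  rw [coeff_zSeriesProd]
  exact sum_mem fun κ _ => Submodule.smul_mem _ _ (zProd_mem_A1 n κ c)

theorem mem_comps {s : Finset ℕ} {k : ℕ} {κ : ℕ → ℕ} :
    κ ∈ comps s k ↔ κ ∈ s.piAntidiag k ∧ ∀ j ∈ s, 1 ≤ κ j := by
  simp [comps]

theorem sum_comps_smul {M : Type*} [AddCommMonoid M] [Module ℚ M] {s : Finset ℕ} {k : ℕ}
    {P : (ℕ → ℕ) → Prop} [DecidablePred P] {f : (ℕ → ℕ) → ℚ} {w : ℕ → PowerSeries ℚ}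
    (hw : ∀ j ∈ s, coeff 0 (w j) = 0)
    (hf : ∀ κ : ℕ → ℕ, (∀ j ∈ s, 1 ≤ κ j) →
      (if P κ then f κ else 0) = ∏ j ∈ s, coeff (κ j) (w j)) (F : (ℕ → ℕ) → M) :
    ∑ κ ∈ comps s k with P κ, f κ • F κ =
      ∑ κ ∈ s.piAntidiag k, (∏ j ∈ s, coeff (κ j) (w j)) • F κ := by
  rw [Finset.sum_filter, comps, Finset.sum_filter]
  refine Finset.sum_congr rfl fun κ _ => ?_
  split_ifs with hκ hP
  · rw [← hf κ hκ, if_pos hP]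
  · rw [← hf κ hκ, if_neg hP, zero_smul]
  · push Not at hκ
    obtain ⟨j, hj, hκj⟩ := hκ
    have h0 : coeff (κ j) (w j) = 0 := by rw [show κ j = 0 by omega, hw j hj]
    rw [Finset.prod_eq_zero hj h0, zero_smul]


/-! ### Bilinear maps on generating series -/

section Bilinear

variable {R S T U : Type*} [CommSemiring R] [Semiring S] [Semiring T] [Semiring U] [Module R S]
  [Module R T] [Module R U]

/-- The extension of a bilinear map to power series, bilinear over the powers of the variable. -/
def bilSeries (B : S →ₗ[R] T →ₗ[R] U) (F : PowerSeries S) (G : PowerSeries T) : PowerSeries U :=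
  mk fun k => ∑ p ∈ antidiagonal k, B (coeff p.1 F) (coeff p.2 G)

theorem coeff_bilSeries (B : S →ₗ[R] T →ₗ[R] U) (F : PowerSeries S) (G : PowerSeries T) (k : ℕ) :
    coeff k (bilSeries B F G) = ∑ p ∈ antidiagonal k, B (coeff p.1 F) (coeff p.2 G) := by
  simp [bilSeries]

theorem coeff_bilSeries_compr₂ {V : Type*} [Semiring V] [Module R V] (B : S →ₗ[R] T →ₗ[R] U)
    (L : U →ₗ[R] V) (F : PowerSeries S) (G : PowerSeries T) (k : ℕ) :
    coeff k (bilSeries (B.compr₂ L) F G) = L (coeff k (bilSeries B F G)) := by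
  simp [coeff_bilSeries, map_sum]

theorem bilSeries_add_left (B : S →ₗ[R] T →ₗ[R] U) (F F' : PowerSeries S) (G : PowerSeries T) :
    bilSeries B (F + F') G = bilSeries B F G + bilSeries B F' G := by
  ext k
  simp [coeff_bilSeries, Finset.sum_add_distrib]

theorem bilSeries_add_right (B : S →ₗ[R] T →ₗ[R] U) (F : PowerSeries S) (G G' : PowerSeries T) :
    bilSeries B F (G + G') = bilSeries B F G + bilSeries B F G' := by
  ext k
  simp [coeff_bilSeries, Finset.sum_add_distrib]

theorem bilSeries_smul_left (B : S →ₗ[R] T →ₗ[R] U) (r : R) (F : PowerSeries S)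
    (G : PowerSeries T) : bilSeries B (r • F) G = r • bilSeries B F G := by
  ext k
  simp [coeff_bilSeries, Finset.smul_sum]

theorem bilSeries_smul_right (B : S →ₗ[R] T →ₗ[R] U) (r : R) (F : PowerSeries S)
    (G : PowerSeries T) : bilSeries B F (r • G) = r • bilSeries B F G := by
  ext k
  simp [coeff_bilSeries, Finset.smul_sum]

theorem bilSeries_X_mul_left (B : S →ₗ[R] T →ₗ[R] U) (F : PowerSeries S) (G : PowerSeries T) :
    bilSeries B (PowerSeries.X * F) G = PowerSeries.X * bilSeries B F G := by
  ext (_ | k)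
  · simp [coeff_bilSeries]
  · simp [coeff_bilSeries, PowerSeries.coeff_succ_X_mul, Finset.Nat.antidiagonal_succ]

theorem bilSeries_X_mul_right (B : S →ₗ[R] T →ₗ[R] U) (F : PowerSeries S) (G : PowerSeries T) :
    bilSeries B F (PowerSeries.X * G) = PowerSeries.X * bilSeries B F G := by
  ext (_ | k)
  · simp [coeff_bilSeries]
  · simp [coeff_bilSeries, PowerSeries.coeff_succ_X_mul, Finset.Nat.antidiagonal_succ']

theorem coeff_bilSeries_one_left (B : S →ₗ[R] T →ₗ[R] U) (G : PowerSeries T) (k : ℕ) :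
    coeff k (bilSeries B 1 G) = B 1 (coeff k G) := by
  rw [coeff_bilSeries, Finset.Nat.sum_antidiagonal_eq_sum_range_succ_mk,
    Finset.sum_eq_single_of_mem 0 (by simp)]
  · simp
  · intro j _ hj
    simp [PowerSeries.coeff_one, hj]

theorem coeff_bilSeries_one_right (B : S →ₗ[R] T →ₗ[R] U) (F : PowerSeries S) (k : ℕ) :
    coeff k (bilSeries B F 1) = B (coeff k F) 1 := by
  rw [coeff_bilSeries, Finset.Nat.sum_antidiagonal_eq_sum_range_succ_mk,
    Finset.sum_eq_single_of_mem k (by simp)]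
  · simp
  · intro j hj hjk
    rw [Finset.mem_range] at hj
    simp [PowerSeries.coeff_one, show k - j ≠ 0 by omega]

end Bilinear

theorem coeff_bilSeries_zSeries_zSeriesProd (B : A N →ₗ[ℚ] A N →ₗ[ℚ] A N) (m k : ℕ) (a : ZMod N)
    (w : ℕ → PowerSeries ℚ) (c : ℕ → ZMod N) :
    coeff k (bilSeries B (zSeries a (w 0)) (zSeriesProd m w c)) =
      ∑ κ ∈ (Finset.Icc 0 m).piAntidiag k,
        (∏ j ∈ Finset.Icc 0 m, coeff (κ j) (w j)) • B (z (κ 0) a) (zProd m κ c) := by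
  have hI : Finset.Icc 0 m = Finset.cons 0 (Finset.Icc 1 m) (by simp) :=
    Finset.Icc_eq_cons_Ioc zero_le
  rw [hI, sum_piAntidiag_cons_prod_smul, coeff_bilSeries]
  refine Finset.sum_congr rfl fun p _ => ?_
  rw [coeff_zSeries, coeff_zSeriesProd, map_smul, LinearMap.smul_apply, map_sum]
  simp only [map_smul, Function.update_self]
  rfl

/-! ### The shuffle product on generating series -/

theorem word_cons (c : Letter N) (w : List (Letter N)) :
    word (c :: w) = FreeAlgebra.ι ℚ c * word w := by
  simp [word]

theorem word_nil : word ([] : List (Letter N)) = 1 := rfl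

theorem linearMap_ext_word {M : Type*} [AddCommMonoid M] [Module ℚ M] {f g : A N →ₗ[ℚ] M}
    (h : ∀ w, f (word w) = g (word w)) : f = g :=
  LinearMap.ext_on_range (Submodule.eq_top_iff'.2 word_mem_span) h

theorem shuffle_one_left (q : A N) : shuffle 1 q = q := by
  have h : shuffle (1 : A N) = LinearMap.id :=
    linearMap_ext_word fun w => by rw [← word_nil, shuffle_word, shuffleWord, LinearMap.id_apply]
  rw [h, LinearMap.id_apply]

theorem shuffle_one_right (p : A N) : shuffle p 1 = p := by
  have h : shuffle.flip (1 : A N) = LinearMap.id := linearMap_ext_word fun w => by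
    rw [LinearMap.flip_apply, ← word_nil, shuffle_word]
    cases w <;> rw [shuffleWord, LinearMap.id_apply]
  exact LinearMap.congr_fun h p

theorem shuffle_ι_mul (c d : Letter N) (p q : A N) :
    shuffle (FreeAlgebra.ι ℚ c * p) (FreeAlgebra.ι ℚ d * q) =
      FreeAlgebra.ι ℚ c * shuffle p (FreeAlgebra.ι ℚ d * q) +
        FreeAlgebra.ι ℚ d * shuffle (FreeAlgebra.ι ℚ c * p) q := by
  let L (c : Letter N) : A N →ₗ[ℚ] A N := LinearMap.mulLeft ℚ (FreeAlgebra.ι ℚ c)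
  have h : shuffle.compl₁₂ (L c) (L d) =
      (shuffle.compl₂ (L d)).compr₂ (L c) + (shuffle ∘ₗ L c).compr₂ (L d) := by
    refine linearMap_ext_word fun v => linearMap_ext_word fun w => ?_
    simp [L, ← word_cons, shuffle_word, shuffleWord]
  simpa [L] using LinearMap.congr_fun₂ h p q

/-- The power series `c t` for a letter `c`. -/
def letterSeries (c : Letter N) : PowerSeries (A N) := PowerSeries.X * C (FreeAlgebra.ι ℚ c)

theorem bilSeries_shuffle_one_left (G : PowerSeries (A N)) : bilSeries shuffle 1 G = G := by
  ext k
  rw [coeff_bilSeries_one_left, shuffle_one_left]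

theorem bilSeries_shuffle_one_right (F : PowerSeries (A N)) : bilSeries shuffle F 1 = F := by
  ext k
  rw [coeff_bilSeries_one_right, shuffle_one_right]

theorem bilSeries_shuffle_letterSeries_mul (c d : Letter N) (F G : PowerSeries (A N)) :
    bilSeries shuffle (letterSeries c * F) (letterSeries d * G) =
      letterSeries c * bilSeries shuffle F (letterSeries d * G) +
        letterSeries d * bilSeries shuffle (letterSeries c * F) G := by
  have hC : bilSeries shuffle (C (FreeAlgebra.ι ℚ c) * F) (C (FreeAlgebra.ι ℚ d) * G) =
      C (FreeAlgebra.ι ℚ c) * bilSeries shuffle F (C (FreeAlgebra.ι ℚ d) * G) +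
        C (FreeAlgebra.ι ℚ d) * bilSeries shuffle (C (FreeAlgebra.ι ℚ c) * F) G := by
    ext k
    simp only [coeff_bilSeries, map_add, PowerSeries.coeff_C_mul, shuffle_ι_mul,
      Finset.sum_add_distrib, Finset.mul_sum]
  have hX (r : A N) (F : PowerSeries (A N)) :
      C r * (PowerSeries.X * F) = PowerSeries.X * (C r * F) := by
    rw [← mul_assoc, (PowerSeries.commute_X (C r)).eq, mul_assoc]
  simp only [letterSeries, mul_assoc, bilSeries_X_mul_left, bilSeries_X_mul_right, hX, hC, mul_add]

theorem z_one (b : ZMod N) : z 1 b = Y b := by simp [z]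

theorem z_succ {k : ℕ} (hk : k ≠ 0) (b : ZMod N) : z (k + 1) b = X * z k b := by
  obtain ⟨j, rfl⟩ := Nat.exists_eq_succ_of_ne_zero hk
  simp [z, pow_succ', mul_assoc]

theorem zSeries_geomSeries (r : ℚ) (b : ZMod N) :
    zSeries b (geomSeries r) =
      letterSeries (Letter.y b) + r • (letterSeries Letter.x * zSeries b (geomSeries r)) := by
  ext k
  rw [map_add, PowerSeries.coeff_smul, letterSeries, letterSeries, mul_assoc]
  rcases k with _ | _ | k
  · simp [coeff_zSeries, coeff_zero_geomSeries]
  · simp [PowerSeries.coeff_succ_X_mul, coeff_zSeries, coeff_geomSeries, coeff_zero_geomSeries,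
      z_one, Y]
  · rw [PowerSeries.coeff_succ_X_mul, PowerSeries.coeff_succ_X_mul, PowerSeries.coeff_C_mul,
      coeff_zSeries, coeff_zSeries, coeff_geomSeries r (by omega), coeff_geomSeries r (by omega),
      z_succ (by omega)]
    simp [X, pow_succ', mul_smul]

theorem eq_of_sub_eq_smul_letterSeries_mul {c : Letter N} {r : ℚ} {F G : PowerSeries (A N)}
    (h : F - G = r • (letterSeries c * (F - G))) : F = G := by
  rw [← sub_eq_zero]
  ext k
  induction k with
  | zero =>
    rw [h, letterSeries, mul_assoc, PowerSeries.coeff_smul]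
    simp
  | succ k ih =>
    rw [h, letterSeries, mul_assoc, PowerSeries.coeff_smul, PowerSeries.coeff_succ_X_mul,
      PowerSeries.coeff_C_mul, ih]
    simp

theorem zSeries_geomSeries_mul (r : ℚ) (b : ZMod N) (V : PowerSeries (A N)) :
    zSeries b (geomSeries r) * V =
      letterSeries (Letter.y b) * V +
        letterSeries Letter.x * (r • (zSeries b (geomSeries r) * V)) := by
  nth_rw 1 [zSeries_geomSeries]
  rw [add_mul, smul_mul_assoc, mul_assoc, mul_smul_comm]

theorem bilSeries_shuffle_zSeries_zSeries_mul_eq_add (r s : ℚ) (a b : ZMod N)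
    (V : PowerSeries (A N)) :
    bilSeries shuffle (zSeries a (geomSeries r)) (zSeries b (geomSeries s) * V) =
      letterSeries (Letter.y a) * (zSeries b (geomSeries s) * V) +
        letterSeries (Letter.y b) * bilSeries shuffle (zSeries a (geomSeries r)) V +
        (r + s) • (letterSeries Letter.x *
          bilSeries shuffle (zSeries a (geomSeries r)) (zSeries b (geomSeries s) * V)) := by
  set x : PowerSeries (A N) := letterSeries Letter.x
  set ya : PowerSeries (A N) := letterSeries (Letter.y a)
  set yb : PowerSeries (A N) := letterSeries (Letter.y b)
  set Z := zSeries a (geomSeries r)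
  set W := zSeries b (geomSeries s) * V
  have hZ : Z = ya * 1 + x * (r • Z) := by simpa using zSeries_geomSeries_mul r a 1
  have hW : W = yb * V + x * (s • W) := zSeries_geomSeries_mul s b V
  calc bilSeries shuffle Z W
      = bilSeries shuffle (ya * 1 + x * (r • Z)) (yb * V + x * (s • W)) := by rw [← hZ, ← hW]
    _ = ya * bilSeries shuffle 1 (yb * V + x * (s • W)) +
          yb * bilSeries shuffle (ya * 1 + x * (r • Z)) V +
          (x * bilSeries shuffle (r • Z) (yb * V + x * (s • W)) +
            x * bilSeries shuffle (ya * 1 + x * (r • Z)) (s • W)) := by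
        simp only [bilSeries_add_left, bilSeries_add_right, bilSeries_shuffle_letterSeries_mul,
          mul_add, x, ya, yb]
        abel
    _ = ya * W + yb * bilSeries shuffle Z V + (r + s) • (x * bilSeries shuffle Z W) := by
        rw [← hZ, ← hW, bilSeries_shuffle_one_left, bilSeries_smul_left, bilSeries_smul_right,
          mul_smul_comm, mul_smul_comm, ← add_smul]

theorem bilSeries_shuffle_zSeries_zSeries_mul (r s : ℚ) (a b : ZMod N) (V : PowerSeries (A N)) :
    bilSeries shuffle (zSeries a (geomSeries r)) (zSeries b (geomSeries s) * V) =
      zSeries a (geomSeries (r + s)) * (zSeries b (geomSeries s) * V) +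
        zSeries b (geomSeries (r + s)) * bilSeries shuffle (zSeries a (geomSeries r)) V := by
  -- Both sides are fixed points of `F ↦ y_a t W + y_b t S + (r + s) x t F`.
  refine eq_of_sub_eq_smul_letterSeries_mul (c := Letter.x) (r := r + s) ?_
  nth_rw 1 [bilSeries_shuffle_zSeries_zSeries_mul_eq_add, zSeries_geomSeries_mul (r + s) a,
    zSeries_geomSeries_mul (r + s) b]
  simp only [mul_sub, mul_add, mul_smul_comm, smul_sub, smul_add]
  abel

/-! ### Insertion of a factor -/

/-- The sequence `c₁, …, c_{i-1}, a, c_i, c_{i+1}, …`, for `i ≥ 1`. -/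
def insertAt {M : Type*} (a : M) (c : ℕ → M) (i j : ℕ) : M :=
  if j < i then c j else if j = i then a else c (j - 1)

theorem insertAt_succ_succ {M : Type*} (a : M) (c : ℕ → M) {i j : ℕ} (hj : 1 ≤ j) :
    insertAt a c (i + 1) (j + 1) = insertAt a (fun j => c (j + 1)) i j := by
  unfold insertAt
  split_ifs <;> first | omega | rfl | (congr 1; omega)

theorem zSeriesProd_insertAt_one (m : ℕ) (w : ℕ → PowerSeries ℚ) (a : ZMod N) (c : ℕ → ZMod N) :
    zSeriesProd (m + 1) w (insertAt a c 1) =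
      zSeries a (w 1) * zSeriesProd m (fun j => w (j + 1)) c := by
  rw [zSeriesProd_succ]
  rfl

theorem zSeriesProd_insertAt_succ (m : ℕ) {i : ℕ} (hi : 1 ≤ i) (w : ℕ → PowerSeries ℚ)
    (a : ZMod N) (c : ℕ → ZMod N) :
    zSeriesProd (m + 1) w (insertAt a c (i + 1)) =
      zSeries (c 1) (w 1) *
        zSeriesProd m (fun j => w (j + 1)) (insertAt a (fun j => c (j + 1)) i) := by
  rw [zSeriesProd_succ, insertAt, if_pos (by omega)]
  congr 1
  exact zSeriesProd_congr (fun _ _ _ => rfl) fun j hj _ => insertAt_succ_succ a c hj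

theorem sum_Icc_one_succ {M : Type*} [AddCommMonoid M] (m : ℕ) (f : ℕ → M) :
    ∑ i ∈ Finset.Icc 1 (m + 1), f i = f 1 + ∑ i ∈ Finset.Icc 1 m, f (i + 1) := by
  rw [Finset.Icc_eq_cons_Ioc (by omega), Finset.sum_cons, ← Finset.Icc_add_one_left_eq_Ioc,
    ← Finset.map_add_right_Icc, Finset.sum_map]
  rfl

theorem bilSeries_shuffle_zSeriesProd (m : ℕ) (r : ℚ) (s : ℕ → ℚ) (hs : s (m + 1) = 0)
    (a : ZMod N) (c : ℕ → ZMod N) :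
    bilSeries shuffle (zSeries a (geomSeries r)) (zSeriesProd m (fun j => geomSeries (s j)) c) =
      ∑ i ∈ Finset.Icc 1 (m + 1),
        zSeriesProd (m + 1) (fun j => geomSeries (if j ≤ i then r + s j else s (j - 1)))
          (insertAt a c i) := by
  induction m generalizing s c with
  | zero =>
    rw [zSeriesProd_zero, bilSeries_shuffle_one_right, zero_add, Finset.Icc_self,
      Finset.sum_singleton, zSeriesProd_insertAt_one, zSeriesProd_zero, mul_one]
    simpa using by rw [hs, add_zero]
  | succ m ih =>
    rw [sum_Icc_one_succ (m + 1), zSeriesProd_succ, bilSeries_shuffle_zSeries_zSeries_mul, ih _ hs,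
      Finset.mul_sum, zSeriesProd_insertAt_one, ← zSeriesProd_succ m (fun j => geomSeries (s j)) c]
    refine congrArg₂ (· + ·) rfl (Finset.sum_congr rfl fun i hi => ?_)
    rw [zSeriesProd_insertAt_succ _ (Finset.mem_Icc.1 hi).1, if_pos (by omega)]
    congr 1
    refine zSeriesProd_congr (fun j hj _ => ?_) fun _ _ _ => rfl
    simp [Nat.sub_add_cancel hj]


/-! ### The harmonic product on generating series -/

theorem one_mem_A1 : (1 : A N) ∈ A1 N := Submodule.subset_span (Or.inl rfl)

theorem zBasis_nil : (zBasis [] : A1 N) = ⟨1, one_mem_A1⟩ :=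
  Subtype.ext (coe_zBasis [])

theorem ofZWord_cons (k : ℕ+) (a : ZMod N) (w : ZWord N) :
    ofZWord ((k, a) :: w) = z (k : ℕ) a * ofZWord w := by
  simp [ofZWord]

theorem z1_eq_zBasis (l : ℕ+) (a : ZMod N) : z1 l a = zBasis [(l, a)] :=
  Subtype.ext (by simp [coe_zBasis, z1, ofZWord])

theorem harmonicProd_zBasis (v w : ZWord N) :
    harmonicProd (zBasis v) (zBasis w) = harmonicWord v w := by
  simp [harmonicProd, Module.Basis.constr_basis]

theorem consZ_zBasis (k : ℕ+) (a : ZMod N) (w : ZWord N) :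
    consZ k a (zBasis w) = zBasis ((k, a) :: w) := by
  simp [consZ, Module.Basis.constr_basis]

theorem harmonicProd_single_consZ (l k : ℕ+) (a b : ZMod N) (v : A1 N) :
    harmonicProd (zBasis [(l, a)]) (consZ k b v) =
      consZ l a (consZ k b v) + consZ k b (harmonicProd (zBasis [(l, a)]) v) +
        consZ (l + k) (a + b) v := by
  have h : harmonicProd (zBasis [(l, a)]) ∘ₗ consZ k b =
      consZ l a ∘ₗ consZ k b + consZ k b ∘ₗ harmonicProd (zBasis [(l, a)]) +
        consZ (l + k) (a + b) := by
    refine zBasis.ext fun w => ?_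
    simp only [LinearMap.comp_apply, LinearMap.add_apply, consZ_zBasis, harmonicProd_zBasis]
    rw [harmonicWord, harmonicWord, harmonicWord, consZ_zBasis, consZ_zBasis]
  exact LinearMap.congr_fun h v

variable (N) in
/-- A linear projection of `𝒜` onto `𝒜¹`. It extends the maps defined on `𝒜¹` to `𝒜`, whose ring
structure is needed to form power series. -/
def projA1 : A N →ₗ[ℚ] A1 N :=
  ((A1 N).subtype.exists_leftInverse_of_injective (A1 N).ker_subtype).choose

theorem projA1_coe (p : A1 N) : projA1 N (p : A N) = p :=
  LinearMap.congr_fun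
    ((A1 N).subtype.exists_leftInverse_of_injective (A1 N).ker_subtype).choose_spec p

variable (N) in
/-- A bilinear extension of the harmonic product to `𝒜`. -/
def harmonicExt : A N →ₗ[ℚ] A N →ₗ[ℚ] A N :=
  (harmonicProd.compl₁₂ (projA1 N) (projA1 N)).compr₂ (A1 N).subtype

theorem harmonicExt_coe (p q : A1 N) : harmonicExt N (p : A N) q = (harmonicProd p q : A1 N) := by
  simp [harmonicExt, projA1_coe]

theorem harmonicExt_z_one {l : ℕ} (hl : 1 ≤ l) (a : ZMod N) : harmonicExt N (z l a) 1 = z l a := by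
  lift l to ℕ+ using hl
  have h := harmonicExt_coe (z1 (l : ℕ) a) ⟨1, one_mem_A1⟩
  rw [← zBasis_nil, z1_eq_zBasis, harmonicProd_zBasis, harmonicWord, ← z1_eq_zBasis,
    zBasis_nil] at h
  exact h

theorem harmonicExt_z_mul {l k : ℕ} (hl : 1 ≤ l) (hk : 1 ≤ k) (a b : ZMod N) {v : A N}
    (hv : v ∈ A1 N) :
    harmonicExt N (z l a) (z k b * v) =
      z l a * (z k b * v) + z k b * harmonicExt N (z l a) v + z (l + k) (a + b) * v := by
  lift l to ℕ+ using hl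
  lift k to ℕ+ using hk
  have h := congrArg Subtype.val (harmonicProd_single_consZ l k a b ⟨v, hv⟩)
  rw [← harmonicExt_coe] at h
  simp only [Submodule.coe_add, coe_consZ] at h
  rw [← harmonicExt_coe, ← z1_eq_zBasis] at h
  simpa [z1] using h

theorem sum_antidiagonal_antidiagonal_assoc {M : Type*} [AddCommMonoid M] (f : ℕ → ℕ → ℕ → M)
    (k : ℕ) :
    ∑ p ∈ antidiagonal k, ∑ q ∈ antidiagonal p.2, f p.1 q.1 q.2 =
      ∑ p ∈ antidiagonal k, ∑ q ∈ antidiagonal p.1, f q.1 q.2 p.2 := by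
  rw [Finset.sum_sigma', Finset.sum_sigma']
  refine Finset.sum_bij' (fun x _ => ⟨(x.1.1 + x.2.1, x.2.2), (x.1.1, x.2.1)⟩)
    (fun x _ => ⟨(x.2.1, x.2.2 + x.1.2), (x.2.2, x.1.2)⟩) ?_ ?_ ?_ ?_ fun _ _ => rfl
  all_goals
    rintro ⟨⟨i, j⟩, ⟨l, m⟩⟩ h
    simp only [Finset.mem_sigma, Finset.HasAntidiagonal.mem_antidiagonal] at h ⊢
    obtain ⟨rfl, rfl⟩ := h
    simp [add_assoc]

theorem coeff_zSeries_mul (g : PowerSeries ℚ) (b : ZMod N) (V : PowerSeries (A N)) (k : ℕ) :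
    coeff k (zSeries b g * V) =
      ∑ p ∈ antidiagonal k, coeff p.1 g • (z p.1 b * coeff p.2 V) := by
  simp only [PowerSeries.coeff_mul, coeff_zSeries, smul_mul_assoc]

theorem harmonicExt_smul_z_smul_z_mul {r s : ℚ} {l k : ℕ} (hl : l = 0 → r = 0)
    (hk : k = 0 → s = 0) (a b : ZMod N) {v : A N} (hv : v ∈ A1 N) :
    harmonicExt N (r • z l a) (s • (z k b * v)) =
      (r • z l a) * (s • (z k b * v)) + s • (z k b * harmonicExt N (r • z l a) v) +
        (r * s) • (z (l + k) (a + b) * v) := by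
  rcases Nat.eq_zero_or_pos l with hl0 | hl0
  · simp [hl hl0]
  rcases Nat.eq_zero_or_pos k with hk0 | hk0
  · simp [hk hk0]
  simp only [map_smul, LinearMap.smul_apply, harmonicExt_z_mul hl0 hk0 a b hv, mul_smul_comm,
    smul_mul_assoc, smul_add, smul_smul, mul_comm s]

theorem bilSeries_harmonicExt_zSeries_zSeries_mul (a b : ZMod N) {f g : PowerSeries ℚ}
    (hf : coeff 0 f = 0) (hg : coeff 0 g = 0) {V : PowerSeries (A N)}
    (hV : ∀ k, coeff k V ∈ A1 N) :
    bilSeries (harmonicExt N) (zSeries a f) (zSeries b g * V) =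
      zSeries a f * (zSeries b g * V) + zSeries b g * bilSeries (harmonicExt N) (zSeries a f) V +
        zSeries (a + b) (f * g) * V := by
  ext k
  have key (l p q : ℕ) := harmonicExt_smul_z_smul_z_mul (r := coeff l f) (s := coeff p g)
    (l := l) (k := p) (by rintro rfl; exact hf) (by rintro rfl; exact hg) a b (hV q)
  simp only [map_add, coeff_bilSeries, PowerSeries.coeff_mul (φ := zSeries a f), coeff_zSeries,
    coeff_zSeries_mul (b := b), map_sum, Finset.mul_sum, Finset.smul_sum, key,
    Finset.sum_add_distrib]
  congr 1
  · congr 1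
    rw [sum_antidiagonal_antidiagonal_assoc fun l p q =>
        coeff p g • (z p b * harmonicExt N (coeff l f • z l a) (coeff q V)),
      sum_antidiagonal_antidiagonal_assoc fun p l q =>
        coeff p g • (z p b * harmonicExt N (coeff l f • z l a) (coeff q V))]
    exact Finset.sum_congr rfl fun p _ => (Finset.Nat.sum_antidiagonal_swap
      (f := fun q => coeff q.2 g • (z q.2 b *
        harmonicExt N (coeff q.1 f • z q.1 a) (coeff p.2 V)))).symm
  · rw [sum_antidiagonal_antidiagonal_assoc fun l p q =>
      (coeff l f * coeff p g) • (z (l + p) (a + b) * coeff q V), coeff_zSeries_mul]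
    refine Finset.sum_congr rfl fun p _ => ?_
    rw [PowerSeries.coeff_mul, Finset.sum_smul]
    exact Finset.sum_congr rfl fun q hq => by
      rw [Finset.HasAntidiagonal.mem_antidiagonal.1 hq]

theorem bilSeries_harmonicExt_zSeries_one (a : ZMod N) {f : PowerSeries ℚ}
    (hf : coeff 0 f = 0) : bilSeries (harmonicExt N) (zSeries a f) 1 = zSeries a f := by
  ext k
  rw [coeff_bilSeries_one_right, coeff_zSeries, map_smul, LinearMap.smul_apply]
  rcases Nat.eq_zero_or_pos k with rfl | hk
  · rw [hf, zero_smul, zero_smul]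
  · rw [harmonicExt_z_one hk]

theorem sum_zSeriesProd_insertAt_succ (m : ℕ) (a : ZMod N) (f : PowerSeries ℚ)
    (w : ℕ → PowerSeries ℚ) (c : ℕ → ZMod N) :
    ∑ i ∈ Finset.Icc 1 (m + 2), zSeriesProd (m + 2) (insertAt f w i) (insertAt a c i) =
      zSeries a f * zSeriesProd (m + 1) w c +
        zSeries (c 1) (w 1) * ∑ i ∈ Finset.Icc 1 (m + 1),
          zSeriesProd (m + 1) (insertAt f (fun j => w (j + 1)) i)
            (insertAt a (fun j => c (j + 1)) i) := by
  rw [sum_Icc_one_succ, zSeriesProd_insertAt_one, Finset.mul_sum]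
  refine congrArg₂ (· + ·) (congrArg₂ (· * ·) rfl ?_) (Finset.sum_congr rfl fun i hi => ?_)
  · refine zSeriesProd_congr (fun j hj _ => ?_) fun _ _ _ => rfl
    simp [insertAt, show j ≠ 0 by omega]
  · have hi1 : 1 ≤ i := (Finset.mem_Icc.1 hi).1
    rw [zSeriesProd_insertAt_succ _ hi1, insertAt, if_pos (by omega)]
    congr 1
    exact zSeriesProd_congr (fun j hj _ => insertAt_succ_succ f w hj) fun _ _ _ => rfl

theorem sum_zSeriesProd_update_succ (m : ℕ) (a : ZMod N) (f : PowerSeries ℚ)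
    (w : ℕ → PowerSeries ℚ) (c : ℕ → ZMod N) :
    ∑ i ∈ Finset.Icc 1 (m + 1), zSeriesProd (m + 1) (Function.update w i (f * w i))
        (Function.update c i (a + c i)) =
      zSeries (a + c 1) (f * w 1) * zSeriesProd m (fun j => w (j + 1)) (fun j => c (j + 1)) +
        zSeries (c 1) (w 1) * ∑ i ∈ Finset.Icc 1 m,
          zSeriesProd m (Function.update (fun j => w (j + 1)) i (f * w (i + 1)))
            (Function.update (fun j => c (j + 1)) i (a + c (i + 1))) := by
  rw [sum_Icc_one_succ, zSeriesProd_succ_update_one, Function.update_self, Finset.mul_sum]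
  refine congrArg₂ (· + ·) rfl (Finset.sum_congr rfl fun i hi => ?_)
  have hi1 : i + 1 ≠ 1 := by simp only [Finset.mem_Icc] at hi; omega
  rw [zSeriesProd_succ, Function.update_of_ne hi1.symm, Function.update_of_ne hi1.symm]
  congr 1
  exact zSeriesProd_congr (fun j _ _ => by simp [Function.update_apply])
    fun j _ _ => by simp [Function.update_apply]

theorem bilSeries_harmonicExt_zSeriesProd (m : ℕ) (a : ZMod N) {f : PowerSeries ℚ}
    (hf : coeff 0 f = 0) {w : ℕ → PowerSeries ℚ} (hw : ∀ j, coeff 0 (w j) = 0)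
    (c : ℕ → ZMod N) :
    bilSeries (harmonicExt N) (zSeries a f) (zSeriesProd m w c) =
      ∑ i ∈ Finset.Icc 1 (m + 1), zSeriesProd (m + 1) (insertAt f w i) (insertAt a c i) +
        ∑ i ∈ Finset.Icc 1 m, zSeriesProd m (Function.update w i (f * w i))
          (Function.update c i (a + c i)) := by
  induction m generalizing w c with
  | zero => simp [zSeriesProd_zero, zSeriesProd_succ, bilSeries_harmonicExt_zSeries_one a hf,
      insertAt]
  | succ m ih =>
    rw [sum_zSeriesProd_insertAt_succ, sum_zSeriesProd_update_succ, zSeriesProd_succ,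
      bilSeries_harmonicExt_zSeries_zSeries_mul a _ hf (hw 1)
        (fun k => coeff_zSeriesProd_mem_A1 _ k _ _), ih fun j => hw (j + 1), mul_add]
    abel

/-! ### The inverse of `ℐ` -/

/-- The word `z_{κ₁,c₁} ⋯ z_{κₙ,cₙ}` as a list of pairs, for positive exponents. -/
def zList (n : ℕ) (κ : ℕ → ℕ) (c : ℕ → ZMod N) : ZWord N :=
  (List.range n).map fun j => ((κ (j + 1) - 1).succPNat, c (j + 1))

theorem zList_succ (n : ℕ) (κ : ℕ → ℕ) (c : ℕ → ZMod N) :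
    zList (n + 1) κ c =
      ((κ 1 - 1).succPNat, c 1) :: zList n (fun j => κ (j + 1)) (fun j => c (j + 1)) := by
  simp [zList, List.range_succ_eq_map, List.map_map, Function.comp_def]

theorem zProd1_eq_zBasis (n : ℕ) (κ : ℕ → ℕ) (c : ℕ → ZMod N) :
    zProd1 n κ c = zBasis (zList n κ c) := by
  refine Subtype.ext ?_
  rw [coe_zBasis, ofZWord, zList, List.map_map]
  rfl

theorem differences_zList (n : ℕ) (κ : ℕ → ℕ) (c : ℕ → ZMod N) (s : ZMod N) :
    differences s (zList n κ c) =
      zList n κ fun j => if j = 1 then c 1 - s else c j - c (j - 1) := by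
  induction n generalizing κ c s with
  | zero => rfl
  | succ n ih =>
    rw [zList_succ, zList_succ, differences, ih]
    refine congrArg₂ _ (by simp) (List.map_congr_left fun j _ => ?_)
    cases j <;> simp

theorem calI_symm_zBasis (w : ZWord N) : calI.symm (zBasis w) = zBasis (differences 0 w) := by
  rw [LinearEquiv.symm_apply_eq, calI, Module.Basis.equiv_apply]
  exact congrArg _ (partialSums_differences 0 w).symm

theorem calI_symm_zProd1 (n : ℕ) (κ : ℕ → ℕ) (c : ℕ → ZMod N) :
    calI.symm (zProd1 n κ c) = zProd1 n κ (diffLabel c) := by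
  simp only [zProd1_eq_zBasis, calI_symm_zBasis, differences_zList, sub_zero]
  rfl

theorem calI_symm_z1 (l : ℕ) (a : ZMod N) : calI.symm (z1 l a) = z1 l a := by
  have h (c : ℕ → ZMod N) : zProd1 1 (fun _ => l) c = z1 l (c 1) :=
    Subtype.ext (by simp [z1, zProd1, zProd])
  have ha := calI_symm_zProd1 1 (fun _ => l) fun _ => a
  rwa [h, h, diffLabel, if_pos rfl] at ha

variable (N) in
/-- A linear extension of `ℐ⁻¹` to `𝒜`. -/
def calISymmExt : A N →ₗ[ℚ] A N := (A1 N).subtype ∘ₗ calI.symm.toLinearMap ∘ₗ projA1 N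

theorem calISymmExt_coe (p : A1 N) : calISymmExt N (p : A N) = (calI.symm p : A1 N) := by
  simp [calISymmExt, projA1_coe]

theorem calISymmExt_coeff_zSeriesProd (n k : ℕ) (w : ℕ → PowerSeries ℚ) (c : ℕ → ZMod N) :
    calISymmExt N (coeff k (zSeriesProd n w c)) = coeff k (zSeriesProd n w (diffLabel c)) := by
  have h (κ : ℕ → ℕ) : calISymmExt N (zProd n κ c) = zProd n κ (diffLabel c) := by
    rw [← show (zProd1 n κ c : A N) = zProd n κ c from rfl, calISymmExt_coe, calI_symm_zProd1]
    rfl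
  simp only [coeff_zSeriesProd, map_sum, map_smul, h]

/-! ### Sums over compositions as coefficients -/

theorem coeff_geomSeries_one {k : ℕ} (hk : 1 ≤ k) : coeff k (geomSeries 1) = 1 := by
  rw [coeff_geomSeries 1 hk, one_pow]

theorem coeff_geomSeries_zero {k : ℕ} (hk : 1 ≤ k) :
    coeff k (geomSeries 0) = if k = 1 then 1 else 0 := by
  rw [coeff_geomSeries 0 hk, zero_pow_eq]
  exact if_congr (by omega) rfl rfl

theorem coeff_geomSeries_one_sub_zero {k : ℕ} (hk : 1 ≤ k) :
    coeff k (geomSeries 1 - geomSeries 0) = if 2 ≤ k then 1 else 0 := by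
  rw [map_sub, coeff_geomSeries_one hk, coeff_geomSeries_zero hk]
  split_ifs <;> first | omega | norm_num

theorem coeff_geomSeries_one_mul_self {k : ℕ} (hk : 1 ≤ k) :
    coeff k (geomSeries 1 * geomSeries 1) = k - 1 := by
  have h : geomSeries 1 * geomSeries 1 =
      PowerSeries.X * (PowerSeries.X * mk fun k => ((1 + k).choose 1 : ℚ)) := by
    rw [← PowerSeries.mk_one_pow_eq_mk_choose_add, geomSeries]
    simp only [one_pow]
    change PowerSeries.X * mk 1 * (PowerSeries.X * mk 1) = _
    ring
  obtain rfl | ⟨j, rfl⟩ : k = 1 ∨ ∃ j, k = j + 2 := by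
    rcases hk.eq_or_lt with h | h
    exacts [Or.inl h.symm, Or.inr (Nat.exists_eq_add_of_le' h)]
  · rw [h, PowerSeries.coeff_succ_X_mul]
    simp
  · rw [h, PowerSeries.coeff_succ_X_mul, PowerSeries.coeff_succ_X_mul, PowerSeries.coeff_mk,
      Nat.choose_one_right]
    push_cast
    ring

theorem geomSeries_zero : geomSeries 0 = PowerSeries.X := by
  ext (_ | k)
  · simp [coeff_zero_geomSeries]
  · rw [coeff_geomSeries_zero (by omega), PowerSeries.coeff_X]

theorem coeff_geomSeries_one_mul_sub {k : ℕ} (hk : 1 ≤ k) :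
    coeff k (geomSeries 1 * (geomSeries 1 - geomSeries 0)) =
      if 2 ≤ k then (k : ℚ) - 2 else 0 := by
  obtain ⟨j, rfl⟩ := Nat.exists_eq_add_of_le' hk
  rw [mul_sub, map_sub, coeff_geomSeries_one_mul_self hk, geomSeries_zero,
    PowerSeries.coeff_succ_mul_X]
  split_ifs with hj
  · rw [coeff_geomSeries_one (by omega)]
    ring
  · simp [show j = 0 by omega, coeff_zero_geomSeries]

theorem coeff_zero_geomSeries_sub (r s : ℚ) : coeff 0 (geomSeries r - geomSeries s) = 0 := by
  rw [map_sub, coeff_zero_geomSeries, coeff_zero_geomSeries, sub_zero]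

theorem coeff_zero_geomSeries_mul (r : ℚ) (f : PowerSeries ℚ) :
    coeff 0 (geomSeries r * f) = 0 := by
  rw [geomSeries, mul_assoc, PowerSeries.coeff_zero_X_mul]

/-- The weights selecting the families `k₁, k₂, …` with `k₁ ≥ 2`. -/
def admissibleWeight : ℕ → PowerSeries ℚ :=
  Function.update (fun _ => geomSeries 1) 1 (geomSeries 1 - geomSeries 0)

theorem coeff_zero_update {w : ℕ → PowerSeries ℚ} (hw : ∀ j, coeff 0 (w j) = 0) (i : ℕ)
    {g : PowerSeries ℚ} (hg : coeff 0 g = 0) (j : ℕ) : coeff 0 (Function.update w i g j) = 0 := by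
  rcases eq_or_ne j i with rfl | h
  · rwa [Function.update_self]
  · rw [Function.update_of_ne h, hw]

theorem coeff_zero_admissibleWeight (j : ℕ) : coeff 0 (admissibleWeight j) = 0 :=
  coeff_zero_update (fun _ => coeff_zero_geomSeries 1) 1
    (coeff_zero_geomSeries_sub 1 0) j

theorem prod_coeff_update {s : Finset ℕ} {i : ℕ} (hi : i ∈ s) (κ : ℕ → ℕ)
    (w : ℕ → PowerSeries ℚ) (g : PowerSeries ℚ) :
    ∏ j ∈ s, coeff (κ j) (Function.update w i g j) =
      coeff (κ i) g * ∏ j ∈ s.erase i, coeff (κ j) (w j) := by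
  rw [← Finset.mul_prod_erase s _ hi, Function.update_self]
  exact congrArg _ (Finset.prod_congr rfl fun j hj => by
    rw [Function.update_of_ne (Finset.ne_of_mem_erase hj)])

theorem prod_coeff_update_geomSeries_one {s : Finset ℕ} {i : ℕ} (hi : i ∈ s) {κ : ℕ → ℕ}
    (hκ : ∀ j ∈ s, 1 ≤ κ j) (g : PowerSeries ℚ) :
    ∏ j ∈ s, coeff (κ j) (Function.update (fun _ => geomSeries 1) i g j) = coeff (κ i) g := by
  rw [prod_coeff_update hi, Finset.prod_eq_one, mul_one]
  exact fun j hj => coeff_geomSeries_one (hκ j (Finset.mem_of_mem_erase hj))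

theorem sum_comps_apply_zProd (B : A N →ₗ[ℚ] A N →ₗ[ℚ] A N) {m : ℕ} (hm : 1 ≤ m) (k : ℕ)
    (a : ZMod N) (c : ℕ → ZMod N) :
    ∑ κ ∈ comps (Finset.Icc 0 m) k with 2 ≤ κ 1, B (z (κ 0) a) (zProd m κ c) =
      coeff k (bilSeries B (zSeries a (geomSeries 1)) (zSeriesProd m admissibleWeight c)) := by
  rw [show geomSeries 1 = admissibleWeight 0 from rfl, coeff_bilSeries_zSeries_zSeriesProd,
    ← sum_comps_smul (P := fun κ => 2 ≤ κ 1) (f := 1) fun j _ => coeff_zero_admissibleWeight j]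
  · simp
  · intro κ hκ
    have h1 : 1 ∈ Finset.Icc 0 m := by simpa using hm
    rw [admissibleWeight, prod_coeff_update_geomSeries_one h1 hκ,
      coeff_geomSeries_one_sub_zero (hκ 1 h1), Pi.one_apply]

section

variable {n : ℕ} (k : ℕ) (c : ℕ → ZMod N) {P : (ℕ → ℕ) → Prop} [DecidablePred P]
  {f : (ℕ → ℕ) → ℚ}

theorem sum_comps_smul_zProd {w : ℕ → PowerSeries ℚ} (hw : ∀ j, coeff 0 (w j) = 0)
    (hf : ∀ κ : ℕ → ℕ, (∀ j ∈ Finset.Icc 1 n, 1 ≤ κ j) →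
      (if P κ then f κ else 0) = ∏ j ∈ Finset.Icc 1 n, coeff (κ j) (w j)) :
    ∑ κ ∈ comps (Finset.Icc 1 n) k with P κ, f κ • zProd n κ c =
      coeff k (zSeriesProd n w c) := by
  rw [coeff_zSeriesProd, sum_comps_smul (fun j _ => hw j) hf]

theorem sum_comps_smul_zProd_update {i : ℕ} (hi : i ∈ Finset.Icc 1 n) {g : PowerSeries ℚ}
    (hg : coeff 0 g = 0)
    (hf : ∀ κ : ℕ → ℕ, 1 ≤ κ i → (if P κ then f κ else 0) = coeff (κ i) g) :
    ∑ κ ∈ comps (Finset.Icc 1 n) k with P κ, f κ • zProd n κ c =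
      coeff k (zSeriesProd n (Function.update (fun _ => geomSeries 1) i g) c) :=
  sum_comps_smul_zProd k c (coeff_zero_update (fun _ => coeff_zero_geomSeries 1) i hg)
    fun κ hκ => by rw [prod_coeff_update_geomSeries_one hi hκ, hf κ (hκ i hi)]

theorem sum_comps_smul_zProd_update_update {i i' : ℕ} (hi : i ∈ Finset.Icc 1 n)
    (hi' : i' ∈ Finset.Icc 1 n) (hii' : i ≠ i') {g g' : PowerSeries ℚ} (hg : coeff 0 g = 0)
    (hg' : coeff 0 g' = 0)
    (hf : ∀ κ : ℕ → ℕ, 1 ≤ κ i → 1 ≤ κ i' →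
      (if P κ then f κ else 0) = coeff (κ i) g * coeff (κ i') g') :
    ∑ κ ∈ comps (Finset.Icc 1 n) k with P κ, f κ • zProd n κ c =
      coeff k (zSeriesProd n
        (Function.update (Function.update (fun _ => geomSeries 1) i g) i' g') c) :=
  sum_comps_smul_zProd k c
    (coeff_zero_update (coeff_zero_update (fun _ => coeff_zero_geomSeries 1) i hg) i' hg')
    fun κ hκ => by
      rw [prod_coeff_update hi', prod_coeff_update_geomSeries_one
        (Finset.mem_erase.2 ⟨hii', hi⟩) fun j hj => hκ j (Finset.mem_of_mem_erase hj),
        hf κ (hκ i hi) (hκ i' hi'), mul_comm]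

end

/-! ### The weighted sum as a difference of products -/

/-- The weights `2 ^ ((k₁ + ⋯ + k_t) - t) - 2 ^ ((k₂ + ⋯ + k_t) - (t - 1))`, factored into one
series for each exponent. -/
def shuffleWeight (t : ℕ) : ℕ → PowerSeries ℚ :=
  Function.update (fun j => geomSeries (if j ≤ t then 2 else 1)) 1 (geomSeries 2 - geomSeries 1)

theorem coeff_zero_shuffleWeight (t j : ℕ) : coeff 0 (shuffleWeight t j) = 0 :=
  coeff_zero_update (fun _ => coeff_zero_geomSeries _) 1
    (coeff_zero_geomSeries_sub 2 1) j

theorem prod_coeff_shuffleWeight {n t : ℕ} (ht : 1 ≤ t) (htn : t ≤ n) {κ : ℕ → ℕ}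
    (hκ : ∀ j ∈ Finset.Icc 1 n, 1 ≤ κ j) :
    ∏ j ∈ Finset.Icc 1 n, coeff (κ j) (shuffleWeight t j) =
      if 2 ≤ κ 1 then (2 : ℚ) ^ ((∑ j ∈ Finset.Icc 1 t, κ j) - t) -
        2 ^ ((∑ j ∈ Finset.Icc 2 t, κ j) - (t - 1)) else 0 := by
  have h1 : 1 ∈ Finset.Icc 1 n := Finset.mem_Icc.2 ⟨le_rfl, ht.trans htn⟩
  have hκ1 : 1 ≤ κ 1 := hκ 1 h1
  have hκt : ∀ j ∈ Finset.Icc 2 t, 1 ≤ κ j := fun j hj =>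
    hκ j (Finset.Icc_subset_Icc one_le_two htn hj)
  have hfilter : {j ∈ (Finset.Icc 1 n).erase 1 | j ≤ t} = Finset.Icc 2 t := by
    ext j
    simp only [Finset.mem_filter, Finset.mem_erase, Finset.mem_Icc]
    omega
  have hcard : ∑ _j ∈ Finset.Icc 2 t, 1 = t - 1 := by simp
  have htail : ∏ j ∈ (Finset.Icc 1 n).erase 1, coeff (κ j) (geomSeries (if j ≤ t then 2 else 1)) =
      2 ^ ((∑ j ∈ Finset.Icc 2 t, κ j) - (t - 1)) := by
    rw [← hcard, ← Finset.sum_tsub_distrib _ hκt, ← Finset.prod_pow_eq_pow_sum, ← hfilter,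
      Finset.prod_filter]
    refine Finset.prod_congr rfl fun j hj => ?_
    rw [coeff_geomSeries _ (hκ j (Finset.mem_of_mem_erase hj)), ite_pow, one_pow]
  have hsum : (∑ j ∈ Finset.Icc 1 t, κ j) - t =
      (κ 1 - 1) + ((∑ j ∈ Finset.Icc 2 t, κ j) - (t - 1)) := by
    have hle := Finset.sum_le_sum hκt
    rw [← Finset.add_sum_Ioc_eq_sum_Icc ht, ← Finset.Icc_add_one_left_eq_Ioc, one_add_one_eq_two]
    omega
  rw [shuffleWeight, prod_coeff_update h1, htail, map_sub, coeff_geomSeries _ hκ1,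
    coeff_geomSeries_one hκ1, hsum, pow_add]
  split_ifs with h
  · ring
  · simp [show κ 1 = 1 by omega]

theorem sum_comps_shuffleWeight {n t : ℕ} (ht : 1 ≤ t) (htn : t ≤ n) (k : ℕ) (c : ℕ → ZMod N) :
    ∑ κ ∈ comps (Finset.Icc 1 n) k with 2 ≤ κ 1,
      ((2 : ℚ) ^ ((∑ j ∈ Finset.Icc 1 t, κ j) - t) -
        (2 : ℚ) ^ ((∑ j ∈ Finset.Icc 2 t, κ j) - (t - 1))) • zProd n κ c =
      coeff k (zSeriesProd n (shuffleWeight t) c) :=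
  sum_comps_smul_zProd k c (coeff_zero_shuffleWeight t) fun _ hκ =>
    (prod_coeff_shuffleWeight ht htn hκ).symm

theorem sum_Icc_one_add_two {M : Type*} [AddCommMonoid M] (m : ℕ) (f : ℕ → M) :
    ∑ i ∈ Finset.Icc 1 (m + 2), f i = f 1 + ∑ i ∈ Finset.Icc 2 (m + 1), f i + f (m + 2) := by
  rw [Finset.sum_Icc_succ_top (by omega), ← Finset.add_sum_Ioc_eq_sum_Icc (by omega),
    ← Finset.Icc_add_one_left_eq_Ioc, one_add_one_eq_two]

theorem zSeriesProd_geomSeries_insertAt_sub (m : ℕ) (a : ZMod N) (c : ℕ → ZMod N) :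
    zSeriesProd (m + 2)
          (Function.update (Function.update (fun _ => geomSeries 1) 1 (geomSeries 2)) 2
            (geomSeries 1)) (insertAt a c 1) -
        zSeriesProd (m + 2)
          (Function.update (Function.update (fun _ => geomSeries 1) 1 (geomSeries 1)) 2
            (geomSeries 0)) (insertAt a c 1) =
      zSeriesProd (m + 2)
          (Function.update (Function.update (fun _ => geomSeries 1) 1 (geomSeries 2)) 2
            (geomSeries 1 - geomSeries 0)) (insertAt a c 1) +
        zSeriesProd (m + 2)
          (Function.update (Function.update (fun _ => geomSeries 1) 1
            (geomSeries 2 - geomSeries 1)) 2 (geomSeries 0)) (insertAt a c 1) := by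
  have h (f g : PowerSeries ℚ) :
      zSeriesProd (m + 2)
          (Function.update (Function.update (fun _ => geomSeries 1) 1 f) 2 g) (insertAt a c 1) =
        zSeries a f * (zSeries (c 1) g *
          zSeriesProd m (fun _ => geomSeries 1) fun j => c (j + 1)) := by
    rw [zSeriesProd_insertAt_one, zSeriesProd_succ]
    rfl
  simp only [h, map_sub]
  noncomm_ring

/-- The ratios `ε, 1, …, 1, 0, 0, …` with `m` ones. The trailing zeros account for the position
behind the last factor in `bilSeries_shuffle_zSeriesProd`. -/
def stepRatio (m : ℕ) (ε : ℚ) (j : ℕ) : ℚ := if j = 1 then ε else if j ≤ m + 1 then 1 else 0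

theorem zSeriesProd_stepRatio (m : ℕ) (ε : ℚ) (c : ℕ → ZMod N) :
    zSeriesProd (m + 1) (fun j => geomSeries (stepRatio m ε j)) c =
      zSeriesProd (m + 1) (Function.update (fun _ => geomSeries 1) 1 (geomSeries ε)) c := by
  refine zSeriesProd_congr (fun j _ hj => ?_) fun _ _ _ => rfl
  rcases eq_or_ne j 1 with rfl | h <;> simp [stepRatio, *]

theorem zSeriesProd_stepRatio_front (m : ℕ) (ε : ℚ) (c : ℕ → ZMod N) :
    zSeriesProd (m + 2) (fun j => geomSeries
        (if j ≤ 1 then 1 + stepRatio m ε j else stepRatio m ε (j - 1))) c =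
      zSeriesProd (m + 2) (Function.update (Function.update (fun _ => geomSeries 1) 1
        (geomSeries (1 + ε))) 2 (geomSeries ε)) c := by
  refine zSeriesProd_congr (fun j hj hjm => ?_) fun _ _ _ => rfl
  obtain rfl | rfl | h : j = 1 ∨ j = 2 ∨ 3 ≤ j := by omega
  · simp [stepRatio]
  · simp [stepRatio]
  · rw [if_neg (by omega), Function.update_of_ne (by omega), Function.update_of_ne (by omega),
      stepRatio, if_neg (by omega), if_pos (by omega)]

theorem zSeriesProd_stepRatio_of_two_le (m : ℕ) (ε : ℚ) {i : ℕ} (hi : 2 ≤ i) (him : i ≤ m + 2)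
    (c : ℕ → ZMod N) :
    zSeriesProd (m + 2) (fun j => geomSeries
        (if j ≤ i then 1 + stepRatio m ε j else stepRatio m ε (j - 1))) c =
      zSeriesProd (m + 2) (Function.update
        (fun j => geomSeries (if j ≤ min i (m + 1) then 2 else 1)) 1 (geomSeries (1 + ε))) c := by
  refine zSeriesProd_congr (fun j hj hjm => ?_) fun _ _ _ => rfl
  rcases eq_or_ne j 1 with rfl | h
  · simp [stepRatio, show 1 ≤ i by omega]
  · rw [Function.update_of_ne h]
    congr 1
    unfold stepRatio
    split_ifs <;> first | omega | norm_num

theorem zSeriesProd_stepRatio_sub (m : ℕ) {i : ℕ} (hi : 2 ≤ i) (him : i ≤ m + 2)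
    (c : ℕ → ZMod N) :
    zSeriesProd (m + 2) (fun j => geomSeries
          (if j ≤ i then 1 + stepRatio m 1 j else stepRatio m 1 (j - 1))) c -
        zSeriesProd (m + 2) (fun j => geomSeries
          (if j ≤ i then 1 + stepRatio m 0 j else stepRatio m 0 (j - 1))) c =
      zSeriesProd (m + 2) (shuffleWeight (min i (m + 1))) c := by
  rw [zSeriesProd_stepRatio_of_two_le m 1 hi him, zSeriesProd_stepRatio_of_two_le m 0 hi him,
    ← zSeriesProd_succ_update_one_sub, shuffleWeight, one_add_one_eq_two, add_zero]

theorem bilSeries_shuffle_zSeriesProd_admissibleWeight (m : ℕ) (a : ZMod N) (c : ℕ → ZMod N) :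
    bilSeries shuffle (zSeries a (geomSeries 1)) (zSeriesProd (m + 1) admissibleWeight c) =
      zSeriesProd (m + 2)
          (Function.update (Function.update (fun _ => geomSeries 1) 1 (geomSeries 2)) 2
            (geomSeries 1 - geomSeries 0)) (insertAt a c 1) +
        zSeriesProd (m + 2)
          (Function.update (Function.update (fun _ => geomSeries 1) 1
            (geomSeries 2 - geomSeries 1)) 2 (geomSeries 0)) (insertAt a c 1) +
        ∑ i ∈ Finset.Icc 2 (m + 1), zSeriesProd (m + 2) (shuffleWeight i) (insertAt a c i) +
        zSeriesProd (m + 2) (shuffleWeight (m + 1)) (insertAt a c (m + 2)) := by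
  have hsplit : bilSeries shuffle (zSeries a (geomSeries 1))
      (zSeriesProd (m + 1) admissibleWeight c) =
      bilSeries shuffle (zSeries a (geomSeries 1))
          (zSeriesProd (m + 1) (fun j => geomSeries (stepRatio m 1 j)) c) -
        bilSeries shuffle (zSeries a (geomSeries 1))
          (zSeriesProd (m + 1) (fun j => geomSeries (stepRatio m 0 j)) c) := by
    rw [eq_sub_iff_add_eq, ← bilSeries_add_right, zSeriesProd_stepRatio, zSeriesProd_stepRatio,
      admissibleWeight, zSeriesProd_succ_update_one_sub, sub_add_cancel]
  rw [hsplit, bilSeries_shuffle_zSeriesProd _ 1 _ (by simp [stepRatio]),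
    bilSeries_shuffle_zSeriesProd _ 1 _ (by simp [stepRatio]), ← Finset.sum_sub_distrib,
    sum_Icc_one_add_two, zSeriesProd_stepRatio_front, zSeriesProd_stepRatio_front,
    zSeriesProd_stepRatio_sub m (by omega) le_rfl, min_eq_right (by omega), one_add_one_eq_two,
    add_zero, zSeriesProd_geomSeries_insertAt_sub]
  congr 2
  refine Finset.sum_congr rfl fun i hi => ?_
  rw [Finset.mem_Icc] at hi
  rw [zSeriesProd_stepRatio_sub m hi.1 (by omega), min_eq_left hi.2]

theorem zSeriesProd_insertAt_admissibleWeight (n : ℕ) {i : ℕ} (hi : 2 ≤ i) (c : ℕ → ZMod N) :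
    zSeriesProd n (insertAt (geomSeries 1) admissibleWeight i) c =
      zSeriesProd n admissibleWeight c := by
  refine zSeriesProd_congr (fun j hj _ => ?_) fun _ _ _ => rfl
  simp only [insertAt, admissibleWeight, Function.update_apply]
  split_ifs <;> first | omega | rfl

theorem bilSeries_harmonicExt_zSeriesProd_admissibleWeight (m : ℕ) (a : ZMod N)
    (c : ℕ → ZMod N) :
    bilSeries (harmonicExt N) (zSeries a (geomSeries 1))
        (zSeriesProd (m + 1) admissibleWeight c) =
      zSeriesProd (m + 2) (Function.update (fun _ => geomSeries 1) 2
          (geomSeries 1 - geomSeries 0)) (insertAt a c 1) +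
        ∑ i ∈ Finset.Icc 1 (m + 1),
          zSeriesProd (m + 2) admissibleWeight (insertAt a c (i + 1)) +
        zSeriesProd (m + 1) (Function.update (fun _ => geomSeries 1) 1
          (geomSeries 1 * (geomSeries 1 - geomSeries 0))) (Function.update c 1 (a + c 1)) +
        ∑ i ∈ Finset.Icc 2 (m + 1), zSeriesProd (m + 1)
          (Function.update admissibleWeight i (geomSeries 1 * geomSeries 1))
          (Function.update c i (a + c i)) := by
  rw [bilSeries_harmonicExt_zSeriesProd _ _ (coeff_zero_geomSeries 1) coeff_zero_admissibleWeight,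
    sum_Icc_one_succ, add_assoc _ (zSeriesProd (m + 1) _ _)]
  have hfront : insertAt (geomSeries 1) admissibleWeight 1 =
      Function.update (fun _ => geomSeries 1) 2 (geomSeries 1 - geomSeries 0) := by
    funext j
    simp only [insertAt, admissibleWeight, Function.update_apply]
    split_ifs <;> first | omega | rfl
  rw [hfront]
  refine congrArg₂ _ (congrArg₂ _ rfl (Finset.sum_congr rfl fun i hi => ?_)) ?_
  · rw [Finset.mem_Icc] at hi
    exact zSeriesProd_insertAt_admissibleWeight _ (by omega) _
  · rw [← Finset.add_sum_Ioc_eq_sum_Icc (by omega), ← Finset.Icc_add_one_left_eq_Ioc]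
    refine congrArg₂ _ (by simp [admissibleWeight]) (Finset.sum_congr rfl fun i hi => ?_)
    rw [Finset.mem_Icc] at hi
    rw [show admissibleWeight i = geomSeries 1 from Function.update_of_ne (by omega) _ _]

theorem diffLabel_insertAt_one (a : ZMod N) (α : ℕ → ZMod N) {j : ℕ} (hj : 1 ≤ j) :
    diffLabel (insertAt a α 1) j = frontDiffLabel a α j := by
  simp only [diffLabel, insertAt, frontDiffLabel]
  split_ifs <;> first | omega | rfl | (subst_vars; rfl)

theorem diffLabel_insertAt {a : ZMod N} {α : ℕ → ZMod N} {i j : ℕ} (hi : 2 ≤ i) (hj : 1 ≤ j) :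
    diffLabel (insertAt a α i) j = midDiffLabel a α i j := by
  simp only [diffLabel, insertAt, midDiffLabel]
  split_ifs <;> first | omega | rfl | (subst_vars; rfl)

theorem diffLabel_insertAt_last {a : ZMod N} {α : ℕ → ZMod N} {n j : ℕ} (hn : 2 ≤ n)
    (hj : 1 ≤ j) (hjn : j ≤ n) : diffLabel (insertAt a α n) j = backDiffLabel a α n j := by
  rw [diffLabel_insertAt hn hj, midDiffLabel, backDiffLabel]
  split_ifs <;> first | omega | rfl

theorem insertLabel_eq_insertAt (a : ZMod N) (α : ℕ → ZMod N) (i : ℕ) :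
    insertLabel a α i = insertAt a (diffLabel α) (i + 1) := by
  funext j
  simp [insertLabel, insertAt]

theorem addLabel_eq_update (a : ZMod N) (α : ℕ → ZMod N) (i : ℕ) :
    addLabel a α i = Function.update (diffLabel α) i (a + diffLabel α i) := by
  funext j
  simp [addLabel, Function.update_apply]

section

variable (m k : ℕ) (c : ℕ → ZMod N)

theorem sum_comps_two_le_two_two_pow_smul :
    ∑ κ ∈ comps (Finset.Icc 1 (m + 2)) k with 2 ≤ κ 2, (2 : ℚ) ^ (κ 1 - 1) • zProd (m + 2) κ c =
      coeff k (zSeriesProd (m + 2)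
        (Function.update (Function.update (fun _ => geomSeries 1) 1 (geomSeries 2)) 2
          (geomSeries 1 - geomSeries 0)) c) := by
  refine sum_comps_smul_zProd_update_update k c (by simp) (by simp) (by simp)
    (coeff_zero_geomSeries 2) (coeff_zero_geomSeries_sub 1 0) fun κ h1 h2 => ?_
  rw [coeff_geomSeries 2 h1, coeff_geomSeries_one_sub_zero h2, mul_ite, mul_one, mul_zero]

theorem sum_comps_two_le_one_two_eq_one_two_pow_sub_one_smul :
    ∑ κ ∈ comps (Finset.Icc 1 (m + 2)) k with 2 ≤ κ 1 ∧ κ 2 = 1,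
        ((2 : ℚ) ^ (κ 1 - 1) - 1) • zProd (m + 2) κ c =
      coeff k (zSeriesProd (m + 2)
        (Function.update (Function.update (fun _ => geomSeries 1) 1
          (geomSeries 2 - geomSeries 1)) 2 (geomSeries 0)) c) := by
  refine sum_comps_smul_zProd_update_update k c (by simp) (by simp) (by simp)
    (coeff_zero_geomSeries_sub 2 1) (coeff_zero_geomSeries 0) fun κ h1 h2 => ?_
  rw [map_sub, coeff_geomSeries 2 h1, coeff_geomSeries_one h1, coeff_geomSeries_zero h2]
  rcases h1.eq_or_lt with h | h
  · simp [← h]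
  · simp [show 2 ≤ κ 1 from h]

theorem sum_comps_two_le_zProd {n i : ℕ} (hi : i ∈ Finset.Icc 1 n) :
    ∑ κ ∈ comps (Finset.Icc 1 n) k with 2 ≤ κ i, zProd n κ c =
      coeff k (zSeriesProd n
        (Function.update (fun _ => geomSeries 1) i (geomSeries 1 - geomSeries 0)) c) := by
  rw [← sum_comps_smul_zProd_update k c hi (coeff_zero_geomSeries_sub 1 0)
    (P := fun κ => 2 ≤ κ i) (f := 1)]
  · simp only [Pi.one_apply, one_smul]
  · exact fun κ hκ => (coeff_geomSeries_one_sub_zero hκ).symm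

theorem sum_comps_two_le_one_sub_two_smul :
    ∑ κ ∈ comps (Finset.Icc 1 (m + 1)) k with 2 ≤ κ 1, ((κ 1 : ℚ) - 2) • zProd (m + 1) κ c =
      coeff k (zSeriesProd (m + 1) (Function.update (fun _ => geomSeries 1) 1
        (geomSeries 1 * (geomSeries 1 - geomSeries 0))) c) :=
  sum_comps_smul_zProd_update k c (by simp) (coeff_zero_geomSeries_mul 1 _)
    fun _ hκ => (coeff_geomSeries_one_mul_sub hκ).symm

theorem sum_comps_two_le_one_sub_one_smul {n i : ℕ} (hi : i ∈ Finset.Icc 2 n) :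
    ∑ κ ∈ comps (Finset.Icc 1 n) k with 2 ≤ κ 1, ((κ i : ℚ) - 1) • zProd n κ c =
      coeff k (zSeriesProd n
        (Function.update admissibleWeight i (geomSeries 1 * geomSeries 1)) c) := by
  rw [Finset.mem_Icc] at hi
  refine sum_comps_smul_zProd_update_update k c (Finset.mem_Icc.2 (by omega))
    (Finset.mem_Icc.2 (by omega)) (by omega) (coeff_zero_geomSeries_sub 1 0)
    (coeff_zero_geomSeries_mul 1 _) fun κ h1 h2 => ?_
  rw [coeff_geomSeries_one_sub_zero h1, coeff_geomSeries_one_mul_self h2, ite_mul, one_mul,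
    zero_mul]

end

theorem calISymmExt_coeff_bilSeries_shuffle (m k : ℕ) (a : ZMod N) (α : ℕ → ZMod N) :
    calISymmExt N (coeff k (bilSeries shuffle (zSeries a (geomSeries 1))
        (zSeriesProd (m + 1) admissibleWeight α))) =
      ∑ κ ∈ comps (Finset.Icc 1 (m + 2)) k with 2 ≤ κ 2,
          (2 : ℚ) ^ (κ 1 - 1) • zProd (m + 2) κ (frontDiffLabel a α) +
        ∑ κ ∈ comps (Finset.Icc 1 (m + 2)) k with 2 ≤ κ 1 ∧ κ 2 = 1,
          ((2 : ℚ) ^ (κ 1 - 1) - 1) • zProd (m + 2) κ (frontDiffLabel a α) +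
        ∑ i ∈ Finset.Icc 2 (m + 1), ∑ κ ∈ comps (Finset.Icc 1 (m + 2)) k with 2 ≤ κ 1,
          ((2 : ℚ) ^ ((∑ j ∈ Finset.Icc 1 i, κ j) - i) -
            (2 : ℚ) ^ ((∑ j ∈ Finset.Icc 2 i, κ j) - (i - 1))) •
              zProd (m + 2) κ (midDiffLabel a α i) +
        ∑ κ ∈ comps (Finset.Icc 1 (m + 2)) k with 2 ≤ κ 1,
          ((2 : ℚ) ^ ((∑ j ∈ Finset.Icc 1 (m + 1), κ j) - (m + 1)) -
            (2 : ℚ) ^ ((∑ j ∈ Finset.Icc 2 (m + 1), κ j) - m)) •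
              zProd (m + 2) κ (backDiffLabel a α (m + 2)) := by
  have hfront (w : ℕ → PowerSeries ℚ) : zSeriesProd (m + 2) w (diffLabel (insertAt a α 1)) =
      zSeriesProd (m + 2) w (frontDiffLabel a α) :=
    zSeriesProd_congr (fun _ _ _ => rfl) fun j hj _ => diffLabel_insertAt_one a α hj
  have hback (w : ℕ → PowerSeries ℚ) : zSeriesProd (m + 2) w (diffLabel (insertAt a α (m + 2))) =
      zSeriesProd (m + 2) w (backDiffLabel a α (m + 2)) :=
    zSeriesProd_congr (fun _ _ _ => rfl) fun j hj hjm => diffLabel_insertAt_last (by omega) hj hjm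
  rw [bilSeries_shuffle_zSeriesProd_admissibleWeight]
  simp only [map_add, map_sum, calISymmExt_coeff_zSeriesProd, hfront, hback]
  rw [sum_comps_two_le_two_two_pow_smul, sum_comps_two_le_one_two_eq_one_two_pow_sub_one_smul,
    ← sum_comps_shuffleWeight (by omega) (by omega), Nat.add_sub_cancel]
  refine congrArg₂ _ (congrArg₂ _ rfl (Finset.sum_congr rfl fun i hi => ?_)) rfl
  rw [Finset.mem_Icc] at hi
  rw [sum_comps_shuffleWeight (by omega) (by omega)]
  exact congrArg _ (zSeriesProd_congr (fun _ _ _ => rfl) fun j hj _ => diffLabel_insertAt hi.1 hj)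

theorem coeff_bilSeries_harmonicExt (m k : ℕ) (a : ZMod N) (α : ℕ → ZMod N) :
    coeff k (bilSeries (harmonicExt N) (zSeries a (geomSeries 1))
        (zSeriesProd (m + 1) admissibleWeight (diffLabel α))) =
      ∑ κ ∈ comps (Finset.Icc 1 (m + 2)) k with 2 ≤ κ 2, zProd (m + 2) κ (insertLabel a α 0) +
        ∑ i ∈ Finset.Icc 1 (m + 1), ∑ κ ∈ comps (Finset.Icc 1 (m + 2)) k with 2 ≤ κ 1,
          zProd (m + 2) κ (insertLabel a α i) +
        ∑ κ ∈ comps (Finset.Icc 1 (m + 1)) k with 2 ≤ κ 1,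
          ((κ 1 : ℚ) - 2) • zProd (m + 1) κ (addLabel a α 1) +
        ∑ i ∈ Finset.Icc 2 (m + 1), ∑ κ ∈ comps (Finset.Icc 1 (m + 1)) k with 2 ≤ κ 1,
          ((κ i : ℚ) - 1) • zProd (m + 1) κ (addLabel a α i) := by
  rw [bilSeries_harmonicExt_zSeriesProd_admissibleWeight]
  simp only [map_add, map_sum, insertLabel_eq_insertAt, addLabel_eq_update]
  rw [sum_comps_two_le_zProd k _ (by simp), sum_comps_two_le_one_sub_two_smul]
  refine congrArg₂ _ (congrArg₂ _ (congrArg₂ _ rfl ?_) rfl)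
    (Finset.sum_congr rfl fun i hi => (sum_comps_two_le_one_sub_one_smul k _ hi).symm)
  exact Finset.sum_congr rfl fun i _ => (sum_comps_two_le_zProd k _ (by simp)).symm

theorem weightedSum_eq_coeff_sub (m k : ℕ) (a : ZMod N) (α : ℕ → ZMod N) :
    weightedSum (m + 2) k a α =
      calISymmExt N (coeff k (bilSeries shuffle (zSeries a (geomSeries 1))
          (zSeriesProd (m + 1) admissibleWeight α))) -
        coeff k (bilSeries (harmonicExt N) (zSeries a (geomSeries 1))
          (zSeriesProd (m + 1) admissibleWeight (diffLabel α))) := by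
  rw [calISymmExt_coeff_bilSeries_shuffle, coeff_bilSeries_harmonicExt, weightedSum,
    show m + 2 - 1 = m + 1 from rfl, show m + 2 - 2 = m from rfl]
  abel

theorem sum_doubleShuffle_eq_weightedSum {n : ℕ} (hn : 2 ≤ n) (k : ℕ) (a : ZMod N)
    (α : ℕ → ZMod N) :
    ((∑ κ ∈ comps (Finset.Icc 0 (n - 1)) k with 2 ≤ κ 1,
      (calI.symm (shuffleA1 (z1 (κ 0) a) (zProd1 (n - 1) κ α)) -
        harmonicProd (calI.symm (z1 (κ 0) a)) (calI.symm (zProd1 (n - 1) κ α))) : A1 N) : A N) =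
      weightedSum n k a α := by
  obtain ⟨m, rfl⟩ := Nat.exists_eq_add_of_le' hn
  rw [weightedSum_eq_coeff_sub, ← coeff_bilSeries_compr₂, ← sum_comps_apply_zProd _ (by omega),
    ← sum_comps_apply_zProd _ (by omega), ← Finset.sum_sub_distrib, AddSubmonoidClass.coe_finsetSum]
  refine Finset.sum_congr rfl fun κ _ => ?_
  rw [Submodule.coe_sub, ← calISymmExt_coe, calI_symm_z1, calI_symm_zProd1, ← harmonicExt_coe]
  rfl

/-! ### Truncated series and the harmonic product -/

/-- The linear extension to `𝒜¹` of the truncation at `M` of the multiple `L`-values. -/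
def truncMap (M : ℕ) : A1 N →ₗ[ℚ] ℂ := zBasis.constr ℚ fun w => LStarTrunc w M

theorem truncMap_zBasis (M : ℕ) (w : ZWord N) : truncMap M (zBasis w) = LStarTrunc w M := by
  simp [truncMap, Module.Basis.constr_basis]

theorem truncMap_zero_consZ (k : ℕ+) (a : ZMod N) (p : A1 N) : truncMap 0 (consZ k a p) = 0 := by
  have h : truncMap 0 ∘ₗ consZ k a = 0 := zBasis.ext fun w => by
    simp [consZ_zBasis, truncMap_zBasis, LStarTrunc]
  exact LinearMap.congr_fun h p

section Truncation

variable [NeZero N]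

theorem omega_pow_val_mul (a : ZMod N) (m : ℕ) :
    omega N ^ (a.val * m) = stdAddChar (a * (m : ZMod N)) := by
  have h : (stdAddChar a : ℂ) = omega N ^ a.val := by
    conv_lhs => rw [← ZMod.natCast_zmod_val a]
    rw [← Int.cast_natCast, ZMod.stdAddChar_coe, omega, ← Complex.exp_nat_mul]
    congr 1
    push_cast
    ring
  rw [pow_mul, ← h, ← AddChar.map_nsmul_eq_pow, nsmul_eq_mul, mul_comm]

theorem LStarTrunc_cons (k : ℕ+) (a : ZMod N) (w : ZWord N) (M : ℕ) :
    LStarTrunc ((k, a) :: w) M = ∑ m ∈ Finset.range M,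
      stdAddChar (a * (m : ZMod N)) / (m : ℂ) ^ (k : ℕ) * LStarTrunc w m := by
  simp only [LStarTrunc, omega_pow_val_mul]
  refine Finset.sum_subset
    (fun m hm => Finset.mem_range.2 (Finset.mem_Ico.1 hm).2) fun m hm hm' => ?_
  obtain rfl : m = 0 := by
    rw [Finset.mem_range] at hm
    rw [Finset.mem_Ico] at hm'
    omega
  simp

theorem LStarTrunc_cons_succ (k : ℕ+) (a : ZMod N) (w : ZWord N) (M : ℕ) :
    LStarTrunc ((k, a) :: w) (M + 1) = LStarTrunc ((k, a) :: w) M +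
      stdAddChar (a * (M : ZMod N)) / (M : ℂ) ^ (k : ℕ) * LStarTrunc w M := by
  rw [LStarTrunc_cons, LStarTrunc_cons, Finset.sum_range_succ]

theorem truncMap_succ_consZ (M : ℕ) (k : ℕ+) (a : ZMod N) (p : A1 N) :
    truncMap (M + 1) (consZ k a p) = truncMap M (consZ k a p) +
      stdAddChar (a * (M : ZMod N)) / (M : ℂ) ^ (k : ℕ) * truncMap M p := by
  have h : truncMap (M + 1) ∘ₗ consZ k a = truncMap M ∘ₗ consZ k a +
      LinearMap.mulLeft ℚ (stdAddChar (a * (M : ZMod N)) / (M : ℂ) ^ (k : ℕ)) ∘ₗ truncMap M := by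
    refine zBasis.ext fun w => ?_
    simp only [LinearMap.comp_apply, LinearMap.add_apply, consZ_zBasis, truncMap_zBasis,
      LinearMap.mulLeft_apply, LStarTrunc_cons_succ]
  exact LinearMap.congr_fun h p

theorem truncMap_harmonicWord : ∀ (M : ℕ) (v w : ZWord N),
    truncMap M (harmonicWord v w) = LStarTrunc v M * LStarTrunc w M
  | M, [], w => by rw [harmonicWord, truncMap_zBasis, LStarTrunc, one_mul]
  | M, p :: v, [] => by rw [harmonicWord, truncMap_zBasis, LStarTrunc.eq_1, mul_one]
  | 0, (k, a) :: v, (l, b) :: w => by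
    simp [harmonicWord, truncMap_zero_consZ, LStarTrunc]
  | M + 1, (k, a) :: v, (l, b) :: w => by
    have h := truncMap_harmonicWord M ((k, a) :: v) ((l, b) :: w)
    rw [harmonicWord, map_add, map_add] at h
    rw [harmonicWord, map_add, map_add, truncMap_succ_consZ, truncMap_succ_consZ,
      truncMap_succ_consZ, truncMap_harmonicWord M, truncMap_harmonicWord M,
      truncMap_harmonicWord M, LStarTrunc_cons_succ, LStarTrunc_cons_succ, add_mul,
      AddChar.map_add_eq_mul, PNat.add_coe, pow_add, ← div_mul_div_comm]
    linear_combination h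

theorem truncMap_harmonicProd (M : ℕ) (p q : A1 N) :
    truncMap M (harmonicProd p q) = truncMap M p * truncMap M q := by
  have h : (harmonicProd (N := N)).compr₂ (truncMap M) =
      (LinearMap.mul ℚ ℂ).compl₁₂ (truncMap M) (truncMap M) := by
    refine zBasis.ext fun v => zBasis.ext fun w => ?_
    simp [harmonicProd_zBasis, truncMap_harmonicWord, truncMap_zBasis]
  exact LinearMap.congr_fun₂ h p q

end Truncation

/-! ### Polylogarithms and the shuffle product -/

/-- The derivation `t d/dt` of power series in `t`. -/
def eulerDerivation : Derivation ℂ (PowerSeries ℂ) (PowerSeries ℂ) :=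
  (PowerSeries.X : PowerSeries ℂ) • PowerSeries.derivative ℂ

theorem coeff_eulerDerivation (f : PowerSeries ℂ) (m : ℕ) :
    coeff m (eulerDerivation f) = m * coeff m f := by
  cases m with
  | zero => simp [eulerDerivation]
  | succ m =>
    rw [eulerDerivation, Derivation.smul_apply, smul_eq_mul, PowerSeries.coeff_succ_X_mul,
      PowerSeries.coeff_derivative]
    push_cast
    ring

theorem eq_of_eulerDerivation_eq {f g : PowerSeries ℂ}
    (h₀ : PowerSeries.constantCoeff f = PowerSeries.constantCoeff g)
    (h : eulerDerivation f = eulerDerivation g) : f = g := by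
  ext m
  rcases eq_or_ne m 0 with rfl | hm
  · simpa using h₀
  · have hm' := congrArg (coeff m) h
    rw [coeff_eulerDerivation, coeff_eulerDerivation] at hm'
    exact mul_left_cancel₀ (Nat.cast_ne_zero.2 hm) hm'

section Polylog

variable [NeZero N]

/-- The series `K_c` for which `K_c dt/t` is the differential form of a letter `c`: the forms of
`x` and `y_a` are `dt/t` and `ω^a dt/(1 - ω^a t)`. -/
def letterKernel : Letter N → PowerSeries ℂ
  | Letter.x => 1
  | Letter.y a => mk fun m => if m = 0 then 0 else stdAddChar (a * (m : ZMod N))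

/-- The integral of `f` against the differential form of a letter, without constant term: the
coefficient of index `0` is a quotient by `0`. -/
def letterIntegral (c : Letter N) : PowerSeries ℂ →ₗ[ℚ] PowerSeries ℂ where
  toFun f := mk fun m => coeff m (letterKernel c * f) / (m : ℂ)
  map_add' f g := by
    ext m
    simp [mul_add, add_div]
  map_smul' r f := by
    ext m
    have h : letterKernel c * (r • f) = r • (letterKernel c * f) := mul_smul_comm _ _ _
    simp only [h, PowerSeries.coeff_mk, RingHom.id_apply, PowerSeries.coeff_smul, smul_div_assoc]

theorem coeff_letterIntegral (c : Letter N) (f : PowerSeries ℂ) (m : ℕ) :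
    coeff m (letterIntegral c f) = coeff m (letterKernel c * f) / (m : ℂ) := by
  simp [letterIntegral]

theorem constantCoeff_letterIntegral (c : Letter N) (f : PowerSeries ℂ) :
    PowerSeries.constantCoeff (letterIntegral c f) = 0 := by
  rw [← PowerSeries.coeff_zero_eq_constantCoeff_apply, coeff_letterIntegral, Nat.cast_zero,
    div_zero]

theorem eulerDerivation_letterIntegral {c : Letter N} {f : PowerSeries ℂ}
    (h : PowerSeries.constantCoeff (letterKernel c * f) = 0) :
    eulerDerivation (letterIntegral c f) = letterKernel c * f := by
  ext m
  rw [coeff_eulerDerivation, coeff_letterIntegral]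
  rcases eq_or_ne m 0 with rfl | hm
  · simpa using h.symm
  · field_simp

/-- The power series of the multiple polylogarithms, that is, of the iterated integrals of the
differential forms of the letters, extended linearly to `𝒜`. -/
def polylog : A N →ₗ[ℚ] PowerSeries ℂ :=
  LinearMap.applyₗ 1 ∘ₗ (FreeAlgebra.lift ℚ letterIntegral).toLinearMap

theorem polylog_one : polylog (1 : A N) = 1 := by simp [polylog]

theorem polylog_ι_mul (c : Letter N) (p : A N) :
    polylog (FreeAlgebra.ι ℚ c * p) = letterIntegral c (polylog p) := by
  simp [polylog]

theorem polylog_word_cons (c : Letter N) (w : List (Letter N)) :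
    polylog (word (c :: w)) = letterIntegral c (polylog (word w)) := by
  rw [word_cons, polylog_ι_mul]

theorem constantCoeff_letterKernel_mul_polylog {c : Letter N} {w : List (Letter N)}
    (h : GoodEnd (c :: w)) :
    PowerSeries.constantCoeff (letterKernel c * polylog (word w)) = 0 := by
  rw [map_mul]
  match c, w, h with
  | Letter.y a, w, _ =>
    rw [← PowerSeries.coeff_zero_eq_constantCoeff_apply, letterKernel, PowerSeries.coeff_mk,
      if_pos rfl, zero_mul]
  | Letter.x, d :: w, _ => rw [polylog_word_cons, constantCoeff_letterIntegral, mul_zero]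
  | Letter.x, [], h =>
    obtain h | ⟨u, a, h⟩ := h
    · simp at h
    · cases u <;> simp at h

theorem polylog_shuffleWord (v w : List (Letter N)) (hv : GoodEnd v) (hw : GoodEnd w) :
    polylog (shuffleWord v w) = polylog (word v) * polylog (word w) := by
  induction v, w using shuffleWord.induct with
  | case1 w => rw [shuffleWord, word_nil, polylog_one, one_mul]
  | case2 c v => rw [shuffleWord, word_nil, polylog_one, mul_one]
  | case3 c v d w ih₁ ih₂ =>
    have hc := constantCoeff_letterKernel_mul_polylog hv
    have hd := constantCoeff_letterKernel_mul_polylog hw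
    rw [shuffleWord, map_add, polylog_ι_mul, polylog_ι_mul, ih₁ hv.tail hw, ih₂ hv hw.tail]
    refine eq_of_eulerDerivation_eq ?_ ?_
    · simp only [map_add, map_mul, polylog_word_cons, constantCoeff_letterIntegral, add_zero,
        mul_zero]
    · rw [map_add, Derivation.leibniz, eulerDerivation_letterIntegral,
        eulerDerivation_letterIntegral, polylog_word_cons, polylog_word_cons,
        eulerDerivation_letterIntegral hc, eulerDerivation_letterIntegral hd, smul_eq_mul,
        smul_eq_mul]
      · ring
      · rw [mul_left_comm, map_mul, hd, mul_zero]
      · rw [← mul_assoc, map_mul, hc, zero_mul]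

theorem polylog_shuffleA1 (p q : A1 N) :
    polylog (shuffleA1 p q : A N) = polylog (p : A N) * polylog (q : A N) := by
  have h : (shuffle.compr₂ polylog).compl₁₂ (A1 N).subtype (A1 N).subtype =
      (LinearMap.mul ℚ (PowerSeries ℂ)).compl₁₂ (polylog ∘ₗ (A1 N).subtype)
        (polylog ∘ₗ (A1 N).subtype) := by
    refine zBasis.ext fun v => zBasis.ext fun w => ?_
    simp [coe_zBasis, ← word_letters, shuffle_word,
      polylog_shuffleWord _ _ (goodEnd_letters v) (goodEnd_letters w)]
  exact LinearMap.congr_fun₂ h p q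

/-! ### Coefficients of polylogarithms -/

theorem coeff_letterKernel_y_mul (a : ZMod N) (f : PowerSeries ℂ) (m : ℕ) :
    coeff m (letterKernel (Letter.y a) * f) = stdAddChar (a * (m : ZMod N)) *
      ∑ j ∈ Finset.range m, stdAddChar (-a * (j : ZMod N)) * coeff j f := by
  rw [mul_comm, PowerSeries.coeff_mul, Finset.Nat.sum_antidiagonal_eq_sum_range_succ
    (fun i j => coeff i f * coeff j (letterKernel (Letter.y a))), Finset.sum_range_succ,
    Finset.mul_sum, Nat.sub_self]
  have h₀ : coeff 0 (letterKernel (Letter.y a)) = 0 := by simp [letterKernel]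
  rw [h₀, mul_zero, add_zero]
  refine Finset.sum_congr rfl fun j hj => ?_
  rw [Finset.mem_range] at hj
  rw [letterKernel, PowerSeries.coeff_mk, if_neg (by omega), Nat.cast_sub hj.le, ← mul_assoc,
    ← AddChar.map_add_eq_mul, mul_comm]
  ring_nf

theorem coeff_polylog_X_pow_mul (r : ℕ) (p : A N) (m : ℕ) :
    coeff m (polylog (X ^ r * p)) = coeff m (polylog p) / (m : ℂ) ^ r := by
  induction r with
  | zero => simp
  | succ r ih =>
    rw [pow_succ', mul_assoc, X, polylog_ι_mul, coeff_letterIntegral, letterKernel, one_mul, ← X,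
      ih, div_div, ← pow_succ]

theorem coeff_polylog_z_mul {k : ℕ} (hk : 1 ≤ k) (a : ZMod N) (p : A N) (m : ℕ) :
    coeff m (polylog (z k a * p)) = stdAddChar (a * (m : ZMod N)) / (m : ℂ) ^ k *
      ∑ j ∈ Finset.range m, stdAddChar (-a * (j : ZMod N)) * coeff j (polylog p) := by
  obtain ⟨r, rfl⟩ := Nat.exists_eq_add_of_le' hk
  rw [z, Nat.add_sub_cancel, mul_assoc, coeff_polylog_X_pow_mul, Y, polylog_ι_mul,
    coeff_letterIntegral, coeff_letterKernel_y_mul, pow_succ]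
  ring

theorem sum_stdAddChar_mul_coeff_polylog (s : ZMod N) (w : ZWord N) {M : ℕ} (hM : 1 ≤ M) :
    ∑ j ∈ Finset.range M, stdAddChar (-s * (j : ZMod N)) * coeff j (polylog (ofZWord w)) =
      LStarTrunc (differences s w) M := by
  induction w generalizing s M with
  | nil =>
    obtain ⟨M, rfl⟩ := Nat.exists_eq_add_of_le' hM
    rw [show ofZWord ([] : ZWord N) = 1 from rfl, polylog_one, differences, LStarTrunc,
      Finset.sum_range_succ']
    simp [PowerSeries.coeff_one]
  | cons p w ih =>
    obtain ⟨k, a⟩ := p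
    rw [differences, LStarTrunc_cons]
    refine Finset.sum_congr rfl fun m _ => ?_
    rw [ofZWord_cons, coeff_polylog_z_mul k.pos]
    rcases Nat.eq_zero_or_pos m with rfl | hm
    · simp
    · rw [ih a hm, sub_eq_neg_add, add_mul, AddChar.map_add_eq_mul]
      ring

theorem coeff_polylog_ofZWord_cons (k : ℕ+) (a : ZMod N) (w : ZWord N) (m : ℕ) :
    coeff m (polylog (ofZWord ((k, a) :: w))) =
      stdAddChar (a * (m : ZMod N)) / (m : ℂ) ^ (k : ℕ) * LStarTrunc (differences a w) m := by
  rw [ofZWord_cons, coeff_polylog_z_mul k.pos]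
  rcases Nat.eq_zero_or_pos m with rfl | hm
  · simp
  · rw [sum_stdAddChar_mul_coeff_polylog a w hm]

theorem truncMap_calI_symm (p : A1 N) {M : ℕ} (hM : 1 ≤ M) :
    truncMap M (calI.symm p) = ∑ j ∈ Finset.range M, coeff j (polylog (p : A N)) := by
  have h : truncMap M ∘ₗ calI.symm.toLinearMap = ∑ j ∈ Finset.range M,
      ((PowerSeries.coeff (R := ℂ) j).restrictScalars ℚ ∘ₗ polylog) ∘ₗ (A1 N).subtype := by
    refine zBasis.ext fun w => ?_
    have hw := sum_stdAddChar_mul_coeff_polylog 0 w hM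
    simp only [neg_zero, zero_mul, AddChar.map_zero_eq_one, one_mul] at hw
    simp [calI_symm_zBasis, truncMap_zBasis, coe_zBasis, hw]
  simpa using LinearMap.congr_fun h p

end Polylog

/-! ### Estimates -/

theorem one_add_log_natCast_nonneg (m : ℕ) : 0 ≤ 1 + Real.log m :=
  add_nonneg zero_le_one (Real.log_natCast_nonneg m)

theorem isLittleO_one_add_log_pow_rpow_atTop (n : ℕ) {r : ℝ} (hr : 0 < r) :
    (fun x => (1 + Real.log x) ^ n) =o[atTop] fun x : ℝ => x ^ r := by
  have h : (fun x => 1 + Real.log x) =O[atTop] Real.log :=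
    Real.isLittleO_const_log_atTop.isBigO.add (Asymptotics.isBigO_refl _ _)
  refine (h.pow n).trans_isLittleO ?_
  simpa using isLittleO_log_rpow_rpow_atTop (n : ℝ) hr

theorem tendsto_one_add_log_pow_div (n : ℕ) :
    Tendsto (fun m : ℕ => (1 + Real.log m) ^ n / (m : ℝ)) atTop (𝓝 0) := by
  have h := (isLittleO_one_add_log_pow_rpow_atTop n one_pos).tendsto_div_nhds_zero
  simpa [Function.comp_def] using h.comp tendsto_natCast_atTop_atTop

theorem summable_one_add_log_pow_div_sq (n : ℕ) :
    Summable fun m : ℕ => (1 + Real.log m) ^ n / (m : ℝ) ^ 2 := by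
  have hs : Summable fun m : ℕ => (m : ℝ) ^ (1 / 2 : ℝ) / (m : ℝ) ^ 2 := by
    refine (Real.summable_nat_rpow (p := -3 / 2).2 (by norm_num)).congr fun m => ?_
    rcases Nat.eq_zero_or_pos m with rfl | hm
    · norm_num
    · rw [← Real.rpow_natCast, ← Real.rpow_sub (by positivity)]
      norm_num
  have h := ((isLittleO_one_add_log_pow_rpow_atTop n one_half_pos).comp_tendsto
    tendsto_natCast_atTop_atTop).isBigO
  refine summable_of_isBigO_nat hs ?_
  exact (h.mul (Asymptotics.isBigO_refl _ _)).congr (fun _ => (div_eq_mul_inv _ _).symm)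
    fun _ => (div_eq_mul_inv _ _).symm

theorem sum_range_inv_succ_le (M : ℕ) :
    ∑ m ∈ Finset.range M, ((m : ℝ) + 1)⁻¹ ≤ 1 + Real.log M := by
  simpa [harmonic] using harmonic_le_one_add_log M

theorem sum_range_inv_le (M : ℕ) : ∑ m ∈ Finset.range M, (m : ℝ)⁻¹ ≤ 1 + Real.log M := by
  refine le_trans ?_ (sum_range_inv_succ_le M)
  cases M with
  | zero => simp
  | succ M =>
    rw [Finset.sum_range_succ', Finset.sum_range_succ]
    simp only [Nat.cast_add, Nat.cast_one, CharP.cast_eq_zero, inv_zero]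
    gcongr
    positivity

section Estimates

variable [NeZero N]

theorem norm_stdAddChar_div_pow_le {k : ℕ+} {d : ℕ} (hd : d ≤ k) (b : ZMod N) (m : ℕ) :
    ‖stdAddChar b / (m : ℂ) ^ (k : ℕ)‖ ≤ ((m : ℝ) ^ d)⁻¹ := by
  rcases Nat.eq_zero_or_pos m with rfl | hm
  · simp
  · rw [norm_div, AddChar.norm_apply, norm_pow, Complex.norm_natCast, one_div]
    exact inv_anti₀ (by positivity) (pow_le_pow_right₀ (by exact_mod_cast hm) hd)

theorem norm_LStarTrunc_le (w : ZWord N) (M : ℕ) :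
    ‖LStarTrunc w M‖ ≤ (1 + Real.log M) ^ w.length := by
  induction w generalizing M with
  | nil => simp [LStarTrunc]
  | cons p w ih =>
    obtain ⟨k, a⟩ := p
    rw [LStarTrunc_cons, List.length_cons, pow_succ']
    calc _ ≤ ∑ m ∈ Finset.range M, (m : ℝ)⁻¹ * (1 + Real.log M) ^ w.length := by
          refine norm_sum_le_of_le _ fun m hm => ?_
          rcases Nat.eq_zero_or_pos m with rfl | hm₀
          · simp
          rw [norm_mul]
          have hlog : Real.log m ≤ Real.log M :=
            Real.log_le_log (by positivity) (by exact_mod_cast (Finset.mem_range.1 hm).le)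
          have hT : ‖LStarTrunc w m‖ ≤ (1 + Real.log M) ^ w.length :=
            (ih m).trans (pow_le_pow_left₀ (one_add_log_natCast_nonneg m) (by linarith) _)
          gcongr
          simpa using norm_stdAddChar_div_pow_le (d := 1) k.pos (a * (m : ZMod N)) m
      _ = (∑ m ∈ Finset.range M, (m : ℝ)⁻¹) * (1 + Real.log M) ^ w.length := by
          rw [Finset.sum_mul]
      _ ≤ _ := by
          have := one_add_log_natCast_nonneg M
          gcongr
          exact sum_range_inv_le M

theorem norm_stdAddChar_div_pow_mul_LStarTrunc_le {k : ℕ+} {d : ℕ} (hd : d ≤ k) (b : ZMod N)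
    (w : ZWord N) (m : ℕ) : ‖stdAddChar b / (m : ℂ) ^ (k : ℕ) * LStarTrunc w m‖ ≤
      (1 + Real.log m) ^ w.length / (m : ℝ) ^ d := by
  rw [norm_mul, mul_comm, div_eq_mul_inv (_ ^ w.length)]
  exact mul_le_mul (norm_LStarTrunc_le w m) (norm_stdAddChar_div_pow_le hd b m) (norm_nonneg _)
    (pow_nonneg (one_add_log_natCast_nonneg m) _)

/-! ### Convergence of the series -/

theorem norm_sum_stdAddChar_mul_le {b : ZMod N} (hb : b ≠ 0) (M : ℕ) :
    ‖∑ m ∈ Finset.range M, (stdAddChar (b * (m : ZMod N)) : ℂ)‖ ≤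
      2 / ‖(stdAddChar b : ℂ) - 1‖ := by
  have hb' : (stdAddChar b : ℂ) ≠ 1 := fun h =>
    hb (ZMod.injective_stdAddChar (by rw [h, AddChar.map_zero_eq_one]))
  have hpow (m : ℕ) : (stdAddChar (b * (m : ZMod N)) : ℂ) = stdAddChar b ^ m := by
    rw [← AddChar.map_nsmul_eq_pow, nsmul_eq_mul, mul_comm]
  rw [Finset.sum_congr rfl fun m _ => hpow m, geom_sum_eq hb', norm_div]
  gcongr
  calc _ ≤ ‖(stdAddChar b : ℂ) ^ M‖ + ‖(1 : ℂ)‖ := norm_sub_le _ _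
    _ = 2 := by
      rw [norm_pow, AddChar.norm_apply]
      norm_num

theorem norm_LStarTrunc_succ_sub_le (w : ZWord N) {m : ℕ} (hm : 1 ≤ m) :
    ‖LStarTrunc w (m + 1) - LStarTrunc w m‖ ≤ (1 + Real.log m) ^ w.length / m := by
  cases w with
  | nil => simp [LStarTrunc]
  | cons p w =>
    obtain ⟨k, a⟩ := p
    rw [LStarTrunc_cons_succ, add_sub_cancel_left, List.length_cons]
    refine (norm_stdAddChar_div_pow_mul_LStarTrunc_le (d := 1) k.pos _ w m).trans ?_
    rw [pow_one]
    gcongr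
    · exact le_add_of_nonneg_right (Real.log_natCast_nonneg m)
    · omega

theorem norm_LStarTrunc_div_succ_sub_le (w : ZWord N) {m : ℕ} (hm : 1 ≤ m) :
    ‖LStarTrunc w (m + 1) / ((m + 1 : ℕ) : ℂ) - LStarTrunc w m / (m : ℂ)‖ ≤
      2 * ((1 + Real.log m) ^ w.length / (m : ℝ) ^ 2) := by
  have hm₀ : (m : ℂ) ≠ 0 := Nat.cast_ne_zero.2 (Nat.one_le_iff_ne_zero.1 hm)
  have hm₁ : ((m + 1 : ℕ) : ℂ) ≠ 0 := Nat.cast_ne_zero.2 m.succ_ne_zero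
  have hle : (m : ℝ) ≤ ((m + 1 : ℕ) : ℝ) := by exact_mod_cast m.le_succ
  set P : ℝ := (1 + Real.log m) ^ w.length
  have : 0 ≤ P := pow_nonneg (one_add_log_natCast_nonneg m) _
  calc _ = ‖(LStarTrunc w (m + 1) - LStarTrunc w m) / ((m + 1 : ℕ) : ℂ) -
        LStarTrunc w m / ((m : ℂ) * ((m + 1 : ℕ) : ℂ))‖ := by
        congr 1
        field_simp
        push_cast
        ring
    _ ≤ ‖(LStarTrunc w (m + 1) - LStarTrunc w m) / ((m + 1 : ℕ) : ℂ)‖ +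
        ‖LStarTrunc w m / ((m : ℂ) * ((m + 1 : ℕ) : ℂ))‖ := norm_sub_le _ _
    _ ≤ P / m / m + P / (m * m) := by
      rw [norm_div, norm_div, norm_mul, Complex.norm_natCast, Complex.norm_natCast]
      gcongr
      · exact norm_LStarTrunc_succ_sub_le w hm
      · exact norm_LStarTrunc_le w m
    _ = 2 * (P / (m : ℝ) ^ 2) := by
      field_simp
      ring

end Estimates

theorem exists_tendsto_sum_range_smul_of_summable_norm_sub {R E : Type*} [NormedRing R]
    [NormedAddCommGroup E] [CompleteSpace E] [Module R E] [IsBoundedSMul R E] {f : ℕ → R}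
    {g : ℕ → E} {K : ℝ} (hf₀ : Tendsto f atTop (𝓝 0))
    (hf : Summable fun m => ‖f (m + 1) - f m‖) (hg : ∀ M, ‖∑ m ∈ Finset.range M, g m‖ ≤ K) :
    ∃ l, Tendsto (fun M => ∑ m ∈ Finset.range M, f m • g m) atTop (𝓝 l) := by
  set G : ℕ → E := fun M => ∑ m ∈ Finset.range M, g m
  have hle (r : R) (M : ℕ) : ‖r • G M‖ ≤ ‖r‖ * K :=
    (norm_smul_le _ _).trans (mul_le_mul_of_nonneg_left (hg M) (norm_nonneg _))
  have hsum : Summable fun m => (f (m + 1) - f m) • G (m + 1) :=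
    Summable.of_norm_bounded (hf.mul_right K) fun m => hle _ _
  have hfG : Tendsto (fun M => f M • G (M + 1)) atTop (𝓝 0) :=
    squeeze_zero_norm (fun M => hle _ _) (by simpa using hf₀.norm.mul_const K)
  refine ⟨_, (tendsto_add_atTop_iff_nat 1).1
    ((hfG.sub hsum.hasSum.tendsto_sum_nat).congr fun M => ?_)⟩
  rw [Finset.sum_range_by_parts f g (M + 1), Nat.add_sub_cancel]

theorem exists_tendsto_LStarTrunc_one [NeZero N] {b : ZMod N} (hb : b ≠ 0) (w : ZWord N) :
    ∃ l, Tendsto (LStarTrunc ((1, b) :: w)) atTop (𝓝 l) := by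
  have hzero : Tendsto (fun m : ℕ => LStarTrunc w m / (m : ℂ)) atTop (𝓝 0) := by
    refine squeeze_zero_norm (fun m => ?_) (tendsto_one_add_log_pow_div w.length)
    rw [norm_div, Complex.norm_natCast]
    gcongr
    exact norm_LStarTrunc_le w m
  have hvar : Summable fun m : ℕ =>
      ‖LStarTrunc w (m + 1) / ((m + 1 : ℕ) : ℂ) - LStarTrunc w m / (m : ℂ)‖ := by
    rw [← summable_nat_add_iff 1]
    exact Summable.of_nonneg_of_le (fun _ => norm_nonneg _)
      (fun m => norm_LStarTrunc_div_succ_sub_le w m.succ_pos)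
      ((summable_nat_add_iff 1).2 ((summable_one_add_log_pow_div_sq w.length).mul_left 2))
  obtain ⟨l, hl⟩ := exists_tendsto_sum_range_smul_of_summable_norm_sub hzero hvar
    (norm_sum_stdAddChar_mul_le hb)
  refine ⟨l, hl.congr fun M => ?_⟩
  rw [LStarTrunc_cons]
  refine Finset.sum_congr rfl fun m _ => ?_
  rw [smul_eq_mul, PNat.one_coe, pow_one]
  ring

theorem tendsto_LStarTrunc [NeZero N] (j : ℕ+) (b : ZMod N) (w : ZWord N) (h : 2 ≤ j ∨ b ≠ 0) :
    Tendsto (LStarTrunc ((j, b) :: w)) atTop (𝓝 (LStarValue ((j, b) :: w))) := by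
  refine tendsto_nhds_limUnder ?_
  rcases (one_le : 1 ≤ j).eq_or_lt with rfl | hj
  · exact exists_tendsto_LStarTrunc_one (h.resolve_left (by decide)) w
  · have hs := Summable.of_norm_bounded (summable_one_add_log_pow_div_sq w.length) fun m =>
      norm_stdAddChar_div_pow_mul_LStarTrunc_le (d := 2) (by exact_mod_cast hj)
        (b * (m : ZMod N)) w m
    exact ⟨_, hs.hasSum.tendsto_sum_nat.congr fun M => (LStarTrunc_cons j b w M).symm⟩

/-! ### Cauchy products and products of partial sums -/

theorem sum_Ico_sub_inv_le_one_add_log {j M : ℕ} (hj : j < M) :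
    ∑ i ∈ Finset.Ico (M - j) M, (i : ℝ)⁻¹ ≤ 1 + Real.log j := by
  rw [Finset.sum_Ico_eq_sum_range, Nat.sub_sub_self hj.le]
  refine le_trans (Finset.sum_le_sum fun i _ => ?_) (sum_range_inv_succ_le j)
  have h : i + 1 ≤ M - j + i := by omega
  exact inv_anti₀ (by positivity) (by exact_mod_cast h)

theorem sum_Ico_sub_inv_le_mul_inv {j M : ℕ} (hj : j < M) :
    ∑ i ∈ Finset.Ico (M - j) M, (i : ℝ)⁻¹ ≤ j * ((M - j : ℕ) : ℝ)⁻¹ := by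
  have hpos : (0 : ℝ) < (M - j : ℕ) := Nat.cast_pos.2 (Nat.sub_pos_of_lt hj)
  calc _ ≤ (Finset.Ico (M - j) M).card • ((M - j : ℕ) : ℝ)⁻¹ :=
        Finset.sum_le_card_nsmul _ _ _ fun i hi =>
          inv_anti₀ hpos (Nat.cast_le.2 (Finset.mem_Ico.1 hi).1)
    _ = _ := by rw [Nat.card_Ico, Nat.sub_sub_self hj.le, nsmul_eq_mul]

theorem sum_range_mul_sum_range_sub_sum_antidiagonal {R : Type*} [Ring R] (f g : ℕ → R) (M : ℕ) :
    (∑ i ∈ Finset.range M, f i) * ∑ j ∈ Finset.range M, g j -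
        ∑ m ∈ Finset.range M, ∑ p ∈ antidiagonal m, f p.1 * g p.2 =
      ∑ j ∈ Finset.range M, (∑ i ∈ Finset.Ico (M - j) M, f i) * g j := by
  have h : ∑ m ∈ Finset.range M, ∑ p ∈ antidiagonal m, f p.1 * g p.2 =
      ∑ j ∈ Finset.range M, (∑ i ∈ Finset.range (M - j), f i) * g j := by
    simp only [Finset.sum_mul]
    rw [← Finset.sum_range_diag_flip M fun j i => f i * g j]
    refine Finset.sum_congr rfl fun m _ => ?_
    rw [← Finset.Nat.sum_antidiagonal_swap]
    exact Finset.Nat.sum_antidiagonal_eq_sum_range_succ (fun j i => f i * g j) m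
  rw [h, Finset.mul_sum, ← Finset.sum_sub_distrib]
  refine Finset.sum_congr rfl fun j _ => ?_
  rw [← Finset.sum_range_add_sum_Ico f (Nat.sub_le M j), add_mul, add_sub_cancel_left]

section CauchyProduct

variable {R : Type*} [NormedRing R] {f : ℕ → R} (hf : ∀ i, ‖f i‖ ≤ (i : ℝ)⁻¹)
include hf

theorem tendsto_sum_Ico_sub_mul (j : ℕ) (r : R) :
    Tendsto (fun M => (∑ i ∈ Finset.Ico (M - j) M, f i) * r) atTop (𝓝 0) := by
  have hinv : Tendsto (fun M : ℕ => (j * ((M - j : ℕ) : ℝ)⁻¹) * ‖r‖) atTop (𝓝 0) := by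
    have h := (tendsto_inv_atTop_nhds_zero_nat (𝕜 := ℝ)).comp (tendsto_sub_atTop_nat j)
    simpa [Function.comp_def] using (h.const_mul (j : ℝ)).mul_const ‖r‖
  refine squeeze_zero_norm' ?_ hinv
  filter_upwards [eventually_gt_atTop j] with M hM
  refine (norm_mul_le _ _).trans (mul_le_mul_of_nonneg_right ?_ (norm_nonneg r))
  exact (norm_sum_le_of_le _ fun i _ => hf i).trans (sum_Ico_sub_inv_le_mul_inv hM)

theorem tendsto_sum_range_mul_sum_range_sub_sum_antidiagonal [CompleteSpace R] {g : ℕ → R}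
    (hg : Summable fun j : ℕ => (1 + Real.log j) * ‖g j‖) :
    Tendsto (fun M => (∑ i ∈ Finset.range M, f i) * ∑ j ∈ Finset.range M, g j -
      ∑ m ∈ Finset.range M, ∑ p ∈ antidiagonal m, f p.1 * g p.2) atTop (𝓝 0) := by
  have hlim : Tendsto (fun M => ∑' j, (Finset.range M : Set ℕ).indicator
      (fun j => (∑ i ∈ Finset.Ico (M - j) M, f i) * g j) j) atTop (𝓝 (∑' _ : ℕ, (0 : R))) := by
    refine tendsto_tsum_of_dominated_convergence hg (fun j => ?_) (.of_forall fun M j => ?_)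
    · refine (tendsto_sum_Ico_sub_mul hf j (g j)).congr' ?_
      filter_upwards [eventually_gt_atTop j] with M hM
      rw [Set.indicator_of_mem (by simpa using hM)]
    · by_cases hj : j < M
      · rw [Set.indicator_of_mem (by simpa using hj)]
        refine (norm_mul_le _ _).trans (mul_le_mul_of_nonneg_right ?_ (norm_nonneg _))
        exact (norm_sum_le_of_le _ fun i _ => hf i).trans (sum_Ico_sub_inv_le_one_add_log hj)
      · rw [Set.indicator_of_notMem (by simpa using hj), norm_zero]
        exact mul_nonneg (one_add_log_natCast_nonneg j) (norm_nonneg _)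
  rw [tsum_zero] at hlim
  refine hlim.congr fun M => ?_
  rw [sum_range_mul_sum_range_sub_sum_antidiagonal, sum_eq_tsum_indicator]

end CauchyProduct

/-! ### The evaluation map -/

theorem tendsto_truncMap_doubleShuffle [NeZero N] (l : ℕ+) {k : ℕ+} (hk : 2 ≤ k) (a b : ZMod N)
    (w : ZWord N) :
    Tendsto (fun M => truncMap M
      (calI.symm (shuffleA1 (zBasis [(l, a)]) (zBasis ((k, b) :: w))) -
        harmonicProd (calI.symm (zBasis [(l, a)])) (calI.symm (zBasis ((k, b) :: w)))))
      atTop (𝓝 0) := by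
  set f : ℕ → ℂ := fun i => coeff i (polylog (ofZWord [(l, a)])) with hf
  set g : ℕ → ℂ := fun j => coeff j (polylog (ofZWord ((k, b) :: w))) with hg
  have hfle (i : ℕ) : ‖f i‖ ≤ (i : ℝ)⁻¹ := by
    simpa [hf, coeff_polylog_ofZWord_cons, differences, LStarTrunc] using
      norm_stdAddChar_div_pow_le (d := 1) l.pos (a * (i : ZMod N)) i
  have hgsum : Summable fun j : ℕ => (1 + Real.log j) * ‖g j‖ := by
    refine Summable.of_nonneg_of_le
      (fun j => mul_nonneg (one_add_log_natCast_nonneg j) (norm_nonneg _)) (fun j => ?_)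
      (summable_one_add_log_pow_div_sq ((differences b w).length + 1))
    rw [pow_succ', mul_div_assoc]
    refine mul_le_mul_of_nonneg_left ?_ (one_add_log_natCast_nonneg j)
    simp only [hg, coeff_polylog_ofZWord_cons]
    exact norm_stdAddChar_div_pow_mul_LStarTrunc_le (by exact_mod_cast hk) _ _ j
  have h := (tendsto_sum_range_mul_sum_range_sub_sum_antidiagonal hfle hgsum).neg
  rw [neg_zero] at h
  refine h.congr' ?_
  filter_upwards [eventually_ge_atTop 1] with M hM
  simp only [map_sub, truncMap_harmonicProd, truncMap_calI_symm _ hM, polylog_shuffleA1,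
    coe_zBasis, PowerSeries.coeff_mul, hf, hg, neg_sub]

theorem tendsto_truncMap_doubleShuffle_zProd1 [NeZero N] (n : ℕ) {κ : ℕ → ℕ} (h₀ : 1 ≤ κ 0)
    (h₁ : 2 ≤ κ 1) (a : ZMod N) (α : ℕ → ZMod N) :
    Tendsto (fun M => truncMap M
      (calI.symm (shuffleA1 (z1 (κ 0) a) (zProd1 (n + 1) κ α)) -
        harmonicProd (calI.symm (z1 (κ 0) a)) (calI.symm (zProd1 (n + 1) κ α))))
      atTop (𝓝 0) := by
  have hz : z1 (κ 0) a = zBasis [(⟨κ 0, h₀⟩, a)] := z1_eq_zBasis ⟨κ 0, h₀⟩ a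
  rw [hz, zProd1_eq_zBasis, zList_succ]
  refine tendsto_truncMap_doubleShuffle _ ?_ a _ _
  rw [← PNat.coe_le_coe, Nat.succPNat_coe]
  exact h₁.trans (Nat.le_succ_of_pred_le le_rfl)

variable (N) in
/-- The elements of `𝒜¹` on which the truncated evaluations converge to the value obtained by
linear extension from the multiple `L`-values of the words. On words without a convergent series
that value is the junk value of `limUnder`. -/
def convergent : Submodule ℚ (A1 N) where
  carrier := {p | Tendsto (fun M => truncMap M p) atTop (𝓝 (zBasis.constr ℚ LStarValue p))}
  zero_mem' := by simp
  add_mem' hp hq := by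
    simp only [Set.mem_ofPred_eq, map_add] at hp hq ⊢
    exact hp.add hq
  smul_mem' r p hp := by
    simp only [Set.mem_ofPred_eq, map_smul] at hp ⊢
    exact hp.const_smul r

theorem zBasis_mem_convergent_iff {w : ZWord N} :
    zBasis w ∈ convergent N ↔ Tendsto (LStarTrunc w) atTop (𝓝 (LStarValue w)) := by
  change Tendsto _ _ _ ↔ _
  simp only [truncMap_zBasis, Module.Basis.constr_basis]

theorem zBasis_nil_mem_convergent : zBasis [] ∈ convergent N := by
  refine zBasis_mem_convergent_iff.2 (tendsto_nhds_limUnder ⟨1, ?_⟩)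
  exact tendsto_const_nhds.congr fun M => by rw [LStarTrunc]

theorem word_mem_map_convergent [NeZero N] {c : Letter N} (hc : c ≠ Letter.y 0)
    (v : List (Letter N)) (a : ZMod N) :
    word (c :: v ++ [Letter.y a]) ∈ (convergent N).map (A1 N).subtype := by
  obtain ⟨w, hw, h⟩ := exists_letters (c :: v) a
  obtain ⟨⟨k, b⟩, w, rfl⟩ := List.exists_cons_of_ne_nil hw
  have hkb : 2 ≤ k ∨ b ≠ 0 := by
    by_contra! hcon
    obtain ⟨hk, rfl⟩ := hcon
    obtain rfl : k = 1 := PNat.eq_one_of_lt_two hk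
    exact hc (List.cons.inj h).1.symm
  refine ⟨_, zBasis_mem_convergent_iff.2 (tendsto_LStarTrunc k b w hkb), ?_⟩
  rw [Submodule.subtype_apply, coe_zBasis, ← word_letters, h]

theorem ι_mul_mul_Y_mem_map_convergent [NeZero N] {c : Letter N} (hc : c ≠ Letter.y 0)
    (u : A N) (a : ZMod N) :
    FreeAlgebra.ι ℚ c * u * Y a ∈ (convergent N).map (A1 N).subtype := by
  have hle : Submodule.span ℚ (Set.range (word (N := N))) ≤
      ((convergent N).map (A1 N).subtype).comap
        (LinearMap.mulLeftRight ℚ (FreeAlgebra.ι ℚ c, Y a)) := by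
    refine Submodule.span_le.2 ?_
    rintro _ ⟨v, rfl⟩
    simpa [word, Y, mul_assoc] using word_mem_map_convergent hc v a
  simpa using hle (word_mem_span u)

theorem A0_le_map_convergent [NeZero N] : A0 N ≤ (convergent N).map (A1 N).subtype := by
  refine Submodule.span_le.2 ?_
  rintro p ((rfl | ⟨u, a, rfl⟩) | ⟨u, a, b, hb, rfl⟩)
  · exact ⟨zBasis [], zBasis_nil_mem_convergent, coe_zBasis []⟩
  · exact ι_mul_mul_Y_mem_map_convergent (by simp) u a
  · exact ι_mul_mul_Y_mem_map_convergent (by simpa using hb) u a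

theorem tendsto_truncMap_LStar [NeZero N] (p : A0 N) :
    Tendsto (fun M => truncMap M (Submodule.inclusion A0_le_A1 p)) atTop (𝓝 (LStar p)) := by
  obtain ⟨q, hq, hqp⟩ := A0_le_map_convergent p.2
  obtain rfl : q = Submodule.inclusion A0_le_A1 p := Subtype.ext hqp
  exact hq

/-! ### Admissibility of the weighted sum -/

theorem ι_mul_mem_A0 {c : Letter N} (hc : c ≠ Letter.y 0) {p : A N} (hp : p ∈ A1pos N) :
    FreeAlgebra.ι ℚ c * p ∈ A0 N := by
  have hle : A1pos N ≤ (A0 N).comap (LinearMap.mulLeft ℚ (FreeAlgebra.ι ℚ c)) := by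
    refine Submodule.span_le.2 ?_
    rintro _ ⟨u, a, rfl⟩
    refine Submodule.subset_span ?_
    rw [LinearMap.mulLeft_apply, ← mul_assoc]
    cases c with
    | x => exact Or.inl (Or.inr ⟨u, a, rfl⟩)
    | y b => exact Or.inr ⟨u, a, b, by simpa using hc, rfl⟩
  exact hle hp

theorem zProd_succ_mem_A1pos (n : ℕ) (κ : ℕ → ℕ) (c : ℕ → ZMod N) :
    zProd (n + 1) κ c ∈ A1pos N :=
  Submodule.subset_span ⟨zProd n κ c * X ^ (κ (n + 1) - 1), c (n + 1), by
    simp [zProd, List.range_succ, z, mul_assoc]⟩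

theorem zProd_succ_mem_A0_of_two_le (n : ℕ) {κ : ℕ → ℕ} (c : ℕ → ZMod N) (h : 2 ≤ κ 1) :
    zProd (n + 1) κ c ∈ A0 N := by
  obtain ⟨r, hr⟩ := Nat.exists_eq_add_of_le' h
  have hX : zProd (n + 1) κ c = X * zProd (n + 1) (Function.update κ 1 (r + 1)) c := by
    rw [zProd_succ, zProd_succ, Function.update_self, hr, z_succ r.succ_ne_zero, mul_assoc]
    rfl
  rw [hX]
  exact ι_mul_mem_A0 (by simp) (zProd_succ_mem_A1pos n _ c)

theorem zProd_mem_A0_of_ne_zero (n : ℕ) {κ : ℕ → ℕ} {c : ℕ → ZMod N} (h : κ 1 = 1)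
    (hc : c 1 ≠ 0) : zProd (n + 2) κ c ∈ A0 N := by
  rw [zProd_succ, h, z_one]
  exact ι_mul_mem_A0 (by simpa using hc) (zProd_succ_mem_A1pos n _ _)

theorem frontDiffLabel_zero (α : ℕ → ZMod N) {j : ℕ} (hj : 1 ≤ j) :
    frontDiffLabel 0 α j = insertLabel 0 α 0 j := by
  obtain rfl | rfl | h : j = 1 ∨ j = 2 ∨ 3 ≤ j := by omega
  · simp [frontDiffLabel, insertLabel]
  · simp [frontDiffLabel, insertLabel, diffLabel]
  · rw [frontDiffLabel, insertLabel, if_neg (by omega), if_neg (by omega), if_neg (by omega),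
      if_neg (by omega)]

-- For `a = 0` and `κ 1 = 1` neither word is in `𝒜⁰`, but then they are equal and cancel.
theorem smul_zProd_frontDiffLabel_sub_zProd_insertLabel_mem_A0 (n : ℕ) {κ : ℕ → ℕ}
    (hκ : 1 ≤ κ 1) (a : ZMod N) (α : ℕ → ZMod N) :
    (2 : ℚ) ^ (κ 1 - 1) • zProd (n + 2) κ (frontDiffLabel a α) -
      zProd (n + 2) κ (insertLabel a α 0) ∈ A0 N := by
  obtain h₁ | h₂ : κ 1 = 1 ∨ 2 ≤ κ 1 := by omega
  · obtain rfl | ha := eq_or_ne a 0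
    · rw [h₁, zProd_congr (κ := κ) (fun _ _ _ => rfl) fun j hj _ => frontDiffLabel_zero α hj]
      simp
    · exact sub_mem
        (Submodule.smul_mem _ _ (zProd_mem_A0_of_ne_zero n h₁ (by simpa [frontDiffLabel])))
        (zProd_mem_A0_of_ne_zero n h₁ (by simpa [insertLabel]))
  · exact sub_mem (Submodule.smul_mem _ _ (zProd_succ_mem_A0_of_two_le _ _ h₂))
      (zProd_succ_mem_A0_of_two_le _ _ h₂)

theorem weightedSum_mem_A0 {n : ℕ} (hn : 2 ≤ n) (k : ℕ) (a : ZMod N) (α : ℕ → ZMod N) :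
    weightedSum n k a α ∈ A0 N := by
  obtain ⟨m, rfl⟩ := Nat.exists_eq_add_of_le' hn
  have hfront : (∑ κ ∈ comps (Finset.Icc 1 (m + 2)) k with 2 ≤ κ 2,
        (2 : ℚ) ^ (κ 1 - 1) • zProd (m + 2) κ (frontDiffLabel a α)) -
      (∑ κ ∈ comps (Finset.Icc 1 (m + 2)) k with 2 ≤ κ 2,
        zProd (m + 2) κ (insertLabel a α 0)) ∈ A0 N := by
    rw [← Finset.sum_sub_distrib]
    refine sum_mem fun κ hκ => ?_
    exact smul_zProd_frontDiffLabel_sub_zProd_insertLabel_mem_A0 m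
      ((mem_comps.1 (Finset.mem_filter.1 hκ).1).2 1 (by simp)) a α
  have hterm (n : ℕ) {κ : ℕ → ℕ} (h : 2 ≤ κ 1) (r : ℚ) (c : ℕ → ZMod N) :
      r • zProd (n + 1) κ c ∈ A0 N :=
    Submodule.smul_mem _ r (zProd_succ_mem_A0_of_two_le n c h)
  have hsmul (n : ℕ) (s : Finset (ℕ → ℕ)) (r : (ℕ → ℕ) → ℚ) (c : ℕ → ZMod N) :
      ∑ κ ∈ s with 2 ≤ κ 1, r κ • zProd (n + 1) κ c ∈ A0 N :=
    sum_mem fun κ hκ => hterm n (Finset.mem_filter.1 hκ).2 _ c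
  have hsecond : (∑ κ ∈ comps (Finset.Icc 1 (m + 2)) k with 2 ≤ κ 1 ∧ κ 2 = 1,
      ((2 : ℚ) ^ (κ 1 - 1) - 1) • zProd (m + 2) κ (frontDiffLabel a α)) ∈ A0 N :=
    sum_mem fun κ hκ => hterm _ (Finset.mem_filter.1 hκ).2.1 _ _
  have hinsert : (∑ i ∈ Finset.Icc 1 (m + 2 - 1),
      ∑ κ ∈ comps (Finset.Icc 1 (m + 2)) k with 2 ≤ κ 1,
        zProd (m + 2) κ (insertLabel a α i)) ∈ A0 N :=
    sum_mem fun i _ => by simpa using hsmul _ _ 1 _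
  have hregroup (S₁ S₂ S₃ S₄ S₅ S₆ S₇ S₈ : A N) : S₁ + S₂ + S₃ + S₄ - S₅ - S₆ - S₇ - S₈ =
      (S₁ - S₅) + S₂ + S₃ + S₄ - S₆ - S₇ - S₈ := by abel
  rw [weightedSum, hregroup]
  exact sub_mem (sub_mem (sub_mem (add_mem (add_mem (add_mem hfront hsecond)
    (sum_mem fun i _ => hsmul _ _ _ _)) (hsmul _ _ _ _)) hinsert) (hsmul _ _ _ _))
    (sum_mem fun i _ => hsmul _ _ _ _)

theorem LStar_weightedSum [NeZero N] {n : ℕ} (hn : 2 ≤ n) (k : ℕ) (a : ZMod N) (α : ℕ → ZMod N)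
    (h : weightedSum n k a α ∈ A0 N) : LStar ⟨weightedSum n k a α, h⟩ = 0 := by
  have hsum : Submodule.inclusion A0_le_A1 ⟨weightedSum n k a α, h⟩ =
      ∑ κ ∈ comps (Finset.Icc 0 (n - 1)) k with 2 ≤ κ 1,
        (calI.symm (shuffleA1 (z1 (κ 0) a) (zProd1 (n - 1) κ α)) -
          harmonicProd (calI.symm (z1 (κ 0) a)) (calI.symm (zProd1 (n - 1) κ α))) :=
    Subtype.ext (sum_doubleShuffle_eq_weightedSum hn k a α).symm
  refine tendsto_nhds_unique (tendsto_truncMap_LStar _) ?_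
  obtain ⟨m, rfl⟩ := Nat.exists_eq_add_of_le' hn
  have hlim := tendsto_finsetSum {κ ∈ comps (Finset.Icc 0 (m + 1)) k | 2 ≤ κ 1} fun κ hκ =>
    tendsto_truncMap_doubleShuffle_zProd1 m
      ((mem_comps.1 (Finset.mem_filter.1 hκ).1).2 0 (by simp)) (Finset.mem_filter.1 hκ).2 a α
  simpa only [hsum, map_sum, Nat.add_succ_sub_one, Finset.sum_const_zero] using hlim

end MultipleL

end

/-- The summation on the left runs over `l = κ 0` and `k₁ = κ 1, …, k_{n-1} = κ (n - 1)`;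
`a_j` is `α j` for `1 ≤ j ≤ n - 1`, and no other value of `α` occurs. The second conjunct
says that the series defining `ℒ_∗` converge. -/
theorem mainTheorem1 (N : ℕ) [NeZero N] (n k : ℕ) (hn : 2 ≤ n) (hk : n + 1 ≤ k)
    (a : ZMod N) (α : ℕ → ZMod N) :
    (((∑ κ ∈ comps (Finset.Icc 0 (n - 1)) k with 2 ≤ κ 1,
        (calI.symm (shuffleA1 (z1 (κ 0) a) (zProd1 (n - 1) κ α)) -
          harmonicProd (calI.symm (z1 (κ 0) a)) (calI.symm (zProd1 (n - 1) κ α))) : A1 N) : A N) =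
      weightedSum n k a α) ∧
    (∀ (j : ℕ+) (b : ZMod N) (w : ZWord N), (2 ≤ j ∨ b ≠ 0) →
      Filter.Tendsto (LStarTrunc ((j, b) :: w)) Filter.atTop
        (nhds (LStarValue ((j, b) :: w)))) ∧
    ∃ h : weightedSum n k a α ∈ A0 N, (⟨weightedSum n k a α, h⟩ : A0 N) ∈ LinearMap.ker LStar := by
  exact ⟨sum_doubleShuffle_eq_weightedSum hn k a α, tendsto_LStarTrunc,
    weightedSum_mem_A0 hn k a α, LStar_weightedSum hn k a α _⟩
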